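/- Let $d\ge 1$, $H\in(0,1)$, $\alpha\in(0,1]$ with $\alpha\ne 2H$, and let $(q_n)_{n\ge 0}$ be non-negative reals such that, for some constants $a,A>0$ and $n_0\ge 1$, $$a\,n^{4H-2\alpha-1}\le q_n\le A\,n^{4H-2\alpha-1}\qquad(n\ge n_0).$$ Let $\beta_{i,n},\beta'_{i,n}$ ($1\le i\le d$, $n\ge 0$) be independent real fractional Brownian motions with Hurst parameter $H$ (centred Gaussian processes on $[0,\infty)$ with covariance $\frac12(t^{2H}+s^{2H}-|t-s|^{2H})$), and let $u=(u_1,\dots,u_d)$ be the mild solution of the associated additive stochastic heat equation on the circle $S^1=\mathbb R/2\pi\mathbb Z$, i.e. for all $t\ge 0$, $x\in S^1$, $$u_i(t,x)=\sum_{n\ge 0}\sqrt{q_n}\Bigl(\cos(nx)\int_0^t e^{-n^2(t-s)}\beta_{i,n}(ds)+\sin(nx)\int_0^t e^{-n^2(t-s)}\beta'_{i,n}(ds)\Bigr),$$ with Wiener integrals and convergence in $L^2(\Omega)$. Let $T>0$ and $t_0\in(0,1]$. Then there are non-random constants $c,C,K>0$, depending only on $t_0,T,H,d,\alpha,a,A,n_0$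 and an upper bound for $q_0,\dots,q_{n_0-1}$, such that for every $x\in S^1$ the following hold. 1. For all $s,t\in[t_0,T]$ with $|t-s|\le t_0/2$, $$c\,|t-s|^{\alpha\wedge 2H}\le E\|u(t,x)-u(s,x)\|^2\le C\,|t-s|^{\alpha\wedge 2H}.$$ 2. The process $u(\cdot,x)$ has a version with almost surely continuous paths on $[t_0,T]$. Every such version is almost surely $\beta$-Hölder continuous on $[t_0,T]$ for every $\beta\in(0,\frac{\alpha}{2}\wedge H)$. Moreover $r\mapsto r^{\frac{\alpha}{2}\wedge H}\log^{1/2}(1/r)$ is, up to the factor $K$, an almost sure uniform modulus of continuity for it: almost surely there is a (random) $\varepsilon>0$ such that $\|u(t,x)-u(s,x)\|\le K\,|t-s|^{\frac{\alpha}{2}\wedge H}\log^{1/2}(1/|t-s|)$ for all $s,t\in[t_0,T]$ with $0<|t-s|<\varepsilon$. -/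

import Mathlib

open MeasureTheory ProbabilityTheory Filter Topology
open scoped NNReal ENNReal

noncomputable section

/-- `B = (B t)_{t ≥ 0}` is a real fractional Brownian motion with Hurst parameter `H` under `μ`:
a centred Gaussian process with covariance `(t^{2H} + s^{2H} - |t - s|^{2H}) / 2`. -/
structure IsFractionalBM {Ω : Type*} [MeasurableSpace Ω] (H : ℝ) (B : ℝ≥0 → Ω → ℝ)
    (μ : Measure Ω) : Prop where
  measurable : ∀ t, Measurable (B t)
  gaussian : IsGaussianProcess B μ
  centered : ∀ t, ∫ ω, B t ω ∂μ = 0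
  covariance : ∀ t s, ∫ ω, B t ω * B s ω ∂μ =
    ((t : ℝ) ^ (2 * H) + (s : ℝ) ^ (2 * H) - |(t : ℝ) - s| ^ (2 * H)) / 2

/-- The step function `∑ₚ c(p) 1_{[0,p]}` coded by the finitely supported coefficients `c`. -/
def stepFunction (c : ℝ≥0 →₀ ℝ) (s : ℝ≥0) : ℝ :=
  c.sum fun p a => a * (Set.Icc 0 p).indicator (fun _ => (1 : ℝ)) s

/-- The elementary integral `∑ₚ c(p) B(p)` of the step function `∑ₚ c(p) 1_{[0,p]}`, that is, the
linear extension of `1_{[0,p]} ↦ B(p)`. -/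
def stepIntegral {Ω : Type*} (B : ℝ≥0 → Ω → ℝ) (c : ℝ≥0 →₀ ℝ) (ω : Ω) : ℝ :=
  c.sum fun p a => a * B p ω

/-- `X` is (a version of) the Wiener integral `∫₀ᵗ φ(s) B(ds)`: the step functions on `[0,t]`, with
the scalar product for which `1_{[0,p]} ↦ B(p)` is an isometry into `L²(μ)`, are completed, and `X`
is the value at `φ` of the extended isometry. Concretely, step functions `φₖ` on `[0,t]` converge
uniformly to `φ` on `[0,t]` and their elementary integrals converge to `X` in `L²(μ)` (so that
`φₖ` is Cauchy for the scalar product above). -/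
def IsWienerIntegral {Ω : Type*} [MeasurableSpace Ω] (B : ℝ≥0 → Ω → ℝ) (μ : Measure Ω)
    (t : ℝ≥0) (φ : ℝ≥0 → ℝ) (X : Ω → ℝ) : Prop :=
  MemLp X 2 μ ∧ ∃ c : ℕ → (ℝ≥0 →₀ ℝ),
    (∀ k, ∀ p ∈ (c k).support, p ≤ t) ∧
    TendstoUniformlyOn (fun k => stepFunction (c k)) φ atTop (Set.Icc 0 t) ∧
    Tendsto (fun k => eLpNorm (fun ω => stepIntegral B (c k) ω - X ω) 2 μ) atTop (𝓝 0)

/-- The driving noises of the `d` coordinates: two families `β i n`, `β' i n` of fractional Brownian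
motions with Hurst parameter `H`, all of them independent (as processes). -/
structure IsDrivingNoise {Ω : Type*} [MeasurableSpace Ω] {d : ℕ} (H : ℝ)
    (β β' : Fin d → ℕ → ℝ≥0 → Ω → ℝ) (μ : Measure Ω) : Prop where
  fbm : ∀ i n, IsFractionalBM H (β i n) μ
  fbm' : ∀ i n, IsFractionalBM H (β' i n) μ
  indep : iIndepFun (fun (j : (Fin d × ℕ) ⊕ (Fin d × ℕ)) (ω : Ω) (t : ℝ≥0) =>
    Sum.elim (fun a => β a.1 a.2 t ω) (fun a => β' a.1 a.2 t ω) j) μ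

/-- `u` is the mild (evolution) solution on the circle `ℝ/2πℤ`, with values in `ℝ^d`, of the
stochastic heat equation with spatial Fourier coefficients `q`: for all `t`, `x` and `i`,
`uᵢ(t,x) = ∑ₙ √qₙ (cos(nx) ∫₀ᵗ e^{-n²(t-s)} β_{i,n}(ds) + sin(nx) ∫₀ᵗ e^{-n²(t-s)} β'_{i,n}(ds))`,
where the integrals are Wiener integrals and the series converges in `L²(μ)`. -/
def IsMildSolution {Ω : Type*} [MeasurableSpace Ω] {d : ℕ} (q : ℕ → ℝ)
    (β β' : Fin d → ℕ → ℝ≥0 → Ω → ℝ) (μ : Measure Ω)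
    (u : ℝ≥0 → Real.Angle → Ω → EuclideanSpace ℝ (Fin d)) : Prop :=
  (∀ t x, MemLp (u t x) 2 μ) ∧
  ∃ I I' : Fin d → ℕ → ℝ≥0 → Ω → ℝ,
    (∀ i n t, IsWienerIntegral (β i n) μ t
      (fun s => Real.exp (-(n : ℝ) ^ 2 * ((t : ℝ) - s))) (I i n t)) ∧
    (∀ i n t, IsWienerIntegral (β' i n) μ t
      (fun s => Real.exp (-(n : ℝ) ^ 2 * ((t : ℝ) - s))) (I' i n t)) ∧
    ∀ t x i, Tendsto (fun N : ℕ => eLpNorm (fun ω => u t x ω i -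
      ∑ n ∈ Finset.range N, √(q n) *
        (Real.Angle.cos (n • x) * I i n t ω + Real.Angle.sin (n • x) * I' i n t ω)) 2 μ)
      atTop (𝓝 0)

/-- `v` is a version of the process `y` on `[t₀,T]` with almost surely continuous paths there. -/
def IsContinuousVersionOn {Ω E : Type*} [MeasurableSpace Ω] [TopologicalSpace E] (μ : Measure Ω)
    (t₀ T : ℝ≥0) (y v : ℝ≥0 → Ω → E) : Prop :=
  (∀ t ∈ Set.Icc t₀ T, v t =ᵐ[μ] y t) ∧
  ∀ᵐ ω ∂μ, ContinuousOn (fun t => v t ω) (Set.Icc t₀ T)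

/-- The squared time canonical metric `E ‖u(t,x) - u(s,x)‖²`. -/
def timeMetricSq {Ω : Type*} [MeasurableSpace Ω] {d : ℕ} (μ : Measure Ω)
    (u : ℝ≥0 → Real.Angle → Ω → EuclideanSpace ℝ (Fin d)) (x : Real.Angle) (s t : ℝ≥0) : ℝ :=
  ∫ ω, ‖u t x ω - u s x ω‖ ^ 2 ∂μ

end

/-!
Fractional Brownian motion has a spectral representation: with `ν` proportional to `ξ^{-1-2H} dξ`,
the map `1_{[0,p]} ↦ e^{ipξ} - 1` is an isometry from step functions, with the scalar product given
by the covariance, into `L²(ν)` (`integral_stepIntegral_sq`). Uniform convergence of step functions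
gives pointwise convergence of their images, and convergence of the elementary integrals gives the
Cauchy property in `L²(ν)`; by Fatou's lemma the two limits agree (`tendsto_eLpNorm_stepSymbol_sub`).
This treats all `H ∈ (0,1)` alike, and shows that the increment over `[s,t]` of the Fourier mode with
eigenvalue `l = n²` has variance
`∫ |e^{itξ} - e^{isξ} - (e^{-lt} - e^{-ls})|² ξ² / (l² + ξ²) dν(ξ)`.

With `h = |t - s|`, homogeneity of `ν` bounds this variance by a multiple of `min (l^{-2H}, h^{2H})`
(`exists_incrementVar_le`). Conversely, the frequencies of order `max (l, 1/h)` contribute a fixed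
multiple of this minimum, and for `s, t ≥ t₀` the term `e^{-lt} - e^{-ls}` is exponentially small in
`l`; so the bound is sharp for all large `n` (`exists_le_incrementVar`). As the modes are independent
and `cos² + sin² = 1`, the variance of an increment of a coordinate of `u` is the sum of `qₙ` times
these variances (`IsMildSolution.increment`). Summation of `n^{4H-2α-1} min (n^{-4H}, h^{2H})`, where
the crossover is at `n ≈ h^{-1/2}`, gives the order `h^{min (α, 2H)}` from both sides.

For the paths, the coordinates of increments are limits in `L²` of Gaussian variables. Of Gaussianity
only the sub-Gaussian moment bound with the exact variance is used, which passes to the limit by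
Fatou's lemma (`IsStrictlySubgaussian.of_tendsto`). A union bound and the Borel–Cantelli lemma
control all dyadic increments at the levels `k ≥ m₀(ω)` by a constant times `2^{-γk} √k` with
`γ = min (α/2, H)` (`HasSubgaussianIncrements.ae_dyadicGap`). Chaining along dyadic projections turns
this into the modulus `r^γ √log (1/r)` for every function that is the limit of `u` along the dyadic
projections: such limits define a continuous version, and every continuous version is of this form
because it agrees with `u` at the countably many dyadic points.
-/

/-! ### The spectral measure of fractional Brownian motion -/

/-- The normalizing constant `∫₀^∞ (1 - cos ξ) ξ^{-1-2H} dξ` of the spectral measure. -/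
noncomputable def spectralConst (H : ℝ) : ℝ :=
  ∫ ξ in Set.Ioi (0 : ℝ), ξ ^ (-1 - 2 * H) * (1 - Real.cos ξ)

/-- The spectral measure of fractional Brownian motion with Hurst parameter `H`. It is carried by
the positive half-line only, because all integrands of interest are even, and normalized so that
`∫ 2 (1 - cos (h ξ)) dν(ξ) = |h| ^ (2H)`. -/
noncomputable def spectralMeasure (H : ℝ) : Measure ℝ :=
  (volume.restrict (Set.Ioi 0)).withDensity fun ξ =>
    ((ξ ^ (-1 - 2 * H) / (2 * spectralConst H)).toNNReal : ℝ≥0∞)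

lemma one_sub_cos_le_two_mul_min (x : ℝ) : 1 - Real.cos x ≤ 2 * min 1 (x ^ 2) := by
  rcases min_cases (1 : ℝ) (x ^ 2) with h | h <;> rw [h.1]
  · linarith [Real.neg_one_le_cos x]
  · nlinarith [Real.one_sub_sq_div_two_le_cos (x := x)]

lemma integrableOn_rpow_mul_min {H : ℝ} (hH : H ∈ Set.Ioo (0 : ℝ) 1) :
    IntegrableOn (fun ξ : ℝ => ξ ^ (-1 - 2 * H) * min 1 (ξ ^ 2)) (Set.Ioi 0) := by
  rw [← Set.Ioc_union_Ioi_eq_Ioi (zero_le_one' ℝ)]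
  refine IntegrableOn.union ?_ ?_
  · have h : IntegrableOn (fun ξ : ℝ => ξ ^ (1 - 2 * H)) (Set.Ioc 0 1) := by
      have := intervalIntegral.intervalIntegrable_rpow' (a := 0) (b := 1) (r := 1 - 2 * H)
        (by linarith [hH.2])
      rwa [intervalIntegrable_iff_integrableOn_Ioc_of_le zero_le_one] at this
    refine h.congr_fun (fun ξ hξ => ?_) measurableSet_Ioc
    have h1 : ξ ^ 2 ≤ 1 := by nlinarith [hξ.1, hξ.2]
    simp only [min_eq_right h1]
    rw [← Real.rpow_natCast, ← Real.rpow_add hξ.1]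
    congr 1; push_cast; ring
  · refine (integrableOn_Ioi_rpow_of_lt (a := -1 - 2 * H) (by linarith [hH.1])
      zero_lt_one).congr_fun (fun ξ hξ => ?_) measurableSet_Ioi
    have h1 : 1 ≤ ξ ^ 2 := by nlinarith [Set.mem_Ioi.1 hξ]
    simp [min_eq_left h1]

lemma integrableOn_rpow_mul_of_le_min {H : ℝ} (hH : H ∈ Set.Ioo (0 : ℝ) 1) {f : ℝ → ℝ}
    (hf : Measurable f) {C : ℝ} (hC : ∀ ξ > 0, |f ξ| ≤ C * min 1 (ξ ^ 2)) :
    IntegrableOn (fun ξ : ℝ => ξ ^ (-1 - 2 * H) * f ξ) (Set.Ioi 0) := by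
  refine ((integrableOn_rpow_mul_min hH).const_mul C).mono'
    (by fun_prop) ?_
  refine (ae_restrict_iff' measurableSet_Ioi).2 (Eventually.of_forall fun ξ hξ => ?_)
  have h1 : 0 ≤ ξ ^ (-1 - 2 * H) := Real.rpow_nonneg (le_of_lt hξ) _
  rw [Real.norm_eq_abs, abs_mul, abs_of_nonneg h1]
  nlinarith [hC ξ hξ, mul_le_mul_of_nonneg_left (hC ξ hξ) h1]

/-- The measure `ξ^{-1-2H} dξ` is homogeneous of degree `2H`. -/
lemma setIntegral_rpow_mul_comp {H : ℝ} (f : ℝ → ℝ) {a : ℝ} (ha : 0 < a) :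
    ∫ ξ in Set.Ioi (0 : ℝ), ξ ^ (-1 - 2 * H) * f (a * ξ) =
      a ^ (2 * H) * ∫ ξ in Set.Ioi (0 : ℝ), ξ ^ (-1 - 2 * H) * f ξ := by
  have h := integral_comp_mul_left_Ioi (fun ξ => ξ ^ (-1 - 2 * H) * f ξ) 0 ha
  rw [mul_zero, smul_eq_mul] at h
  have h2 : ∫ ξ in Set.Ioi (0 : ℝ), (a * ξ) ^ (-1 - 2 * H) * f (a * ξ) =
      a ^ (-1 - 2 * H) * ∫ ξ in Set.Ioi (0 : ℝ), ξ ^ (-1 - 2 * H) * f (a * ξ) := by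
    rw [← integral_const_mul]
    refine setIntegral_congr_fun measurableSet_Ioi fun ξ hξ => ?_
    simp only [Real.mul_rpow ha.le (le_of_lt hξ), mul_assoc]
  rw [h2] at h
  have h3 : a ^ (2 * H) * a⁻¹ * a ^ (1 + 2 * H) = a ^ (2 * H) * a ^ (2 * H) := by
    rw [Real.rpow_add ha, Real.rpow_one]; field_simp
  have h4 : a ^ (1 + 2 * H) * a ^ (-1 - 2 * H) = 1 := by
    rw [← Real.rpow_add ha]; ring_nf; simp
  have h5 : a ^ (1 + 2 * H) * a⁻¹ = a ^ (2 * H) := by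
    rw [Real.rpow_add ha, Real.rpow_one]; field_simp
  calc _ = a ^ (1 + 2 * H) * (a ^ (-1 - 2 * H) *
        ∫ ξ in Set.Ioi (0 : ℝ), ξ ^ (-1 - 2 * H) * f (a * ξ)) := by
          rw [← mul_assoc, h4, one_mul]
    _ = _ := by rw [h, ← mul_assoc, h5]

lemma integral_one_sub_cos_mul {m h : ℝ} (hh : 0 < h) (b : ℝ) :
    ∫ ξ in m..b, (1 - Real.cos (h * ξ)) =
      (b - m) - (Real.sin (h * b) - Real.sin (h * m)) / h := by
  rw [intervalIntegral.integral_sub (by simp) (by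
    apply Continuous.intervalIntegrable; fun_prop),
    intervalIntegral.integral_comp_mul_left (fun x => Real.cos x) hh.ne', integral_cos]
  simp; field_simp

/-- At frequencies between `m` and `4m` with `1 / m ≤ h` the oscillation of `cos (h ξ)` averages
out, and with `l ≤ m` the heat multiplier `ξ² / (l² + ξ²)` is at least `1/2`. -/
lemma le_setIntegral_rpow_mul_one_sub_cos {H : ℝ} (hH : H ∈ Set.Ioo (0 : ℝ) 1) {h l m : ℝ}
    (hh : 0 < h) (hl : 0 ≤ l) (hm : 0 < m) (hlm : l ≤ m) (hmh : 1 ≤ m * h) :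
    (4 : ℝ) ^ (-1 - 2 * H) / 2 * m ^ (-(2 * H)) ≤
      ∫ ξ in Set.Ioi (0 : ℝ), ξ ^ (-1 - 2 * H) *
        ((1 - Real.cos (h * ξ)) * (ξ ^ 2 / (l ^ 2 + ξ ^ 2))) := by
  have hcos : ∀ x, 0 ≤ 1 - Real.cos x := fun x => by linarith [Real.cos_le_one x]
  have hfrac : ∀ ξ : ℝ, 0 ≤ ξ ^ 2 / (l ^ 2 + ξ ^ 2) := fun ξ => by positivity
  have hfrac1 : ∀ ξ : ℝ, ξ ^ 2 / (l ^ 2 + ξ ^ 2) ≤ 1 := fun ξ =>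
    div_le_one_of_le₀ (by nlinarith [sq_nonneg l]) (by positivity)
  have hint : IntegrableOn (fun ξ : ℝ => ξ ^ (-1 - 2 * H) *
      ((1 - Real.cos (h * ξ)) * (ξ ^ 2 / (l ^ 2 + ξ ^ 2)))) (Set.Ioi 0) := by
    refine integrableOn_rpow_mul_of_le_min hH (by fun_prop) (C := 2 * (1 + h ^ 2)) fun ξ _ => ?_
    rw [abs_of_nonneg (mul_nonneg (hcos _) (hfrac _))]
    refine (mul_le_of_le_one_right (hcos _) (hfrac1 _)).trans
      ((one_sub_cos_le_two_mul_min _).trans ?_)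
    rw [mul_assoc]
    refine mul_le_mul_of_nonneg_left ?_ zero_le_two
    rcases min_cases (1 : ℝ) (ξ ^ 2) with hc | hc <;> rw [hc.1]
    · exact (min_le_left _ _).trans (by nlinarith [sq_nonneg h])
    · exact (min_le_right _ _).trans (by nlinarith [sq_nonneg ξ])
  set k : ℝ := (4 * m) ^ (-1 - 2 * H) / 2 with hk
  have hk0 : 0 ≤ k := by positivity
  have hsub : Set.Ioc m (4 * m) ⊆ Set.Ioi 0 := fun ξ hξ => hm.trans hξ.1
  calc (4 : ℝ) ^ (-1 - 2 * H) / 2 * m ^ (-(2 * H)) = k * m := by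
        rw [hk, Real.mul_rpow (by norm_num) hm.le, show -(2 * H) = (-1 - 2 * H) + 1 by ring,
          Real.rpow_add hm, Real.rpow_one]; ring
    _ ≤ k * ∫ ξ in m..4 * m, (1 - Real.cos (h * ξ)) := by
        refine mul_le_mul_of_nonneg_left ?_ hk0
        rw [integral_one_sub_cos_mul hh]
        have : (Real.sin (h * (4 * m)) - Real.sin (h * m)) / h ≤ 2 * m := by
          rw [div_le_iff₀ hh]
          linarith [Real.sin_le_one (h * (4 * m)), Real.neg_one_le_sin (h * m)]
        linarith
    _ = ∫ ξ in Set.Ioc m (4 * m), k * (1 - Real.cos (h * ξ)) := by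
        rw [intervalIntegral.integral_of_le (by linarith), integral_const_mul]
    _ ≤ ∫ ξ in Set.Ioc m (4 * m), ξ ^ (-1 - 2 * H) *
          ((1 - Real.cos (h * ξ)) * (ξ ^ 2 / (l ^ 2 + ξ ^ 2))) := by
        refine setIntegral_mono_on ?_ (hint.mono_set hsub) measurableSet_Ioc fun ξ hξ => ?_
        · exact (Continuous.integrableOn_Icc (by fun_prop)).mono_set Set.Ioc_subset_Icc_self
        have h0 : 0 < ξ := hsub hξ
        have h1 : (4 * m) ^ (-1 - 2 * H) ≤ ξ ^ (-1 - 2 * H) :=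
          Real.rpow_le_rpow_of_nonpos h0 hξ.2 (by linarith [hH.1])
        have h2 : 1 / 2 ≤ ξ ^ 2 / (l ^ 2 + ξ ^ 2) := by
          rw [div_le_div_iff₀ two_pos (by positivity)]
          nlinarith [hξ.1]
        have h3 : k ≤ ξ ^ (-1 - 2 * H) * (ξ ^ 2 / (l ^ 2 + ξ ^ 2)) := by
          rw [hk, div_eq_mul_one_div]
          exact mul_le_mul h1 h2 (by norm_num) (by positivity)
        calc _ ≤ (ξ ^ (-1 - 2 * H) * (ξ ^ 2 / (l ^ 2 + ξ ^ 2))) * (1 - Real.cos (h * ξ)) :=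
              mul_le_mul_of_nonneg_right h3 (hcos _)
          _ = _ := by ring
    _ ≤ _ := by
        refine setIntegral_mono_set hint ?_ hsub.eventuallyLE
        refine (ae_restrict_iff' measurableSet_Ioi).2 (Eventually.of_forall fun ξ hξ => ?_)
        exact mul_nonneg (Real.rpow_nonneg (le_of_lt hξ) _) (mul_nonneg (hcos _) (hfrac _))

lemma spectralConst_pos {H : ℝ} (hH : H ∈ Set.Ioo (0 : ℝ) 1) : 0 < spectralConst H := by
  have h := le_setIntegral_rpow_mul_one_sub_cos hH zero_lt_one le_rfl zero_lt_one zero_le_one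
    (by norm_num)
  refine lt_of_lt_of_le (by positivity) (h.trans_eq ?_)
  refine setIntegral_congr_fun measurableSet_Ioi fun ξ hξ => ?_
  have : ξ ≠ 0 := ne_of_gt hξ
  simp [this]

lemma integral_spectralMeasure {H : ℝ} (hH : H ∈ Set.Ioo (0 : ℝ) 1) (f : ℝ → ℝ) :
    ∫ ξ, f ξ ∂spectralMeasure H =
      (2 * spectralConst H)⁻¹ * ∫ ξ in Set.Ioi (0 : ℝ), ξ ^ (-1 - 2 * H) * f ξ := by
  rw [spectralMeasure, integral_withDensity_eq_integral_smul (by fun_prop), ← integral_const_mul]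
  refine setIntegral_congr_fun measurableSet_Ioi fun ξ hξ => ?_
  have h1 : 0 ≤ ξ ^ (-1 - 2 * H) / (2 * spectralConst H) :=
    div_nonneg (Real.rpow_nonneg (le_of_lt hξ) _) (by linarith [spectralConst_pos hH])
  simp only [NNReal.smul_def, Real.coe_toNNReal _ h1, smul_eq_mul]
  ring

lemma integrable_spectralMeasure {H : ℝ} (hH : H ∈ Set.Ioo (0 : ℝ) 1) {f : ℝ → ℝ}
    (hf : Measurable f) {C : ℝ} (hC : ∀ ξ > 0, |f ξ| ≤ C * min 1 (ξ ^ 2)) :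
    Integrable f (spectralMeasure H) := by
  rw [spectralMeasure, integrable_withDensity_iff_integrable_smul (by fun_prop)]
  refine IntegrableOn.congr_fun
    ((integrableOn_rpow_mul_of_le_min hH hf hC).const_mul (2 * spectralConst H)⁻¹)
    (fun ξ hξ => ?_) measurableSet_Ioi
  have h1 : 0 ≤ ξ ^ (-1 - 2 * H) / (2 * spectralConst H) :=
    div_nonneg (Real.rpow_nonneg (le_of_lt hξ) _) (by linarith [spectralConst_pos hH])
  simp only [NNReal.smul_def, Real.coe_toNNReal _ h1, smul_eq_mul]
  ring

lemma integrable_one_sub_cos {H : ℝ} (hH : H ∈ Set.Ioo (0 : ℝ) 1) (h : ℝ) :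
    Integrable (fun ξ => 1 - Real.cos (h * ξ)) (spectralMeasure H) := by
  refine integrable_spectralMeasure hH (by fun_prop) (C := 2 * (1 + h ^ 2)) fun ξ _ => ?_
  rw [abs_of_nonneg (by linarith [Real.cos_le_one (h * ξ)])]
  refine (one_sub_cos_le_two_mul_min _).trans ?_
  rw [mul_assoc]
  refine mul_le_mul_of_nonneg_left ?_ zero_le_two
  rcases min_cases (1 : ℝ) (ξ ^ 2) with hc | hc <;> rw [hc.1]
  · exact (min_le_left _ _).trans (by nlinarith [sq_nonneg h])
  · exact (min_le_right _ _).trans (by nlinarith [sq_nonneg ξ])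

lemma integral_one_sub_cos {H : ℝ} (hH : H ∈ Set.Ioo (0 : ℝ) 1) (h : ℝ) :
    ∫ ξ, (1 - Real.cos (h * ξ)) ∂spectralMeasure H = |h| ^ (2 * H) / 2 := by
  rcases eq_or_ne h 0 with rfl | hh
  · simp [Real.zero_rpow (by linarith [hH.1] : 2 * H ≠ 0)]
  have hcos : ∀ ξ, 1 - Real.cos (h * ξ) = 1 - Real.cos (|h| * ξ) := fun ξ => by
    rcases abs_choice h with e | e <;> rw [e]
    rw [neg_mul, Real.cos_neg]
  simp_rw [hcos]
  rw [integral_spectralMeasure hH,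
    setIntegral_rpow_mul_comp (fun x => 1 - Real.cos x) (abs_pos.2 hh)]
  have := spectralConst_pos hH
  rw [← spectralConst]
  field_simp

lemma integrable_heatMultiplier {H : ℝ} (hH : H ∈ Set.Ioo (0 : ℝ) 1) {l : ℝ} (hl : 0 < l) :
    Integrable (fun ξ => ξ ^ 2 / (l ^ 2 + ξ ^ 2)) (spectralMeasure H) := by
  refine integrable_spectralMeasure hH (by fun_prop) (C := 1 + (l ^ 2)⁻¹) fun ξ _ => ?_
  rw [abs_of_nonneg (by positivity)]
  rcases min_cases (1 : ℝ) (ξ ^ 2) with hc | hc <;> rw [hc.1]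
  · have : ξ ^ 2 / (l ^ 2 + ξ ^ 2) ≤ 1 := div_le_one_of_le₀ (by nlinarith) (by positivity)
    nlinarith [inv_pos.2 (pow_pos hl 2)]
  · have : ξ ^ 2 / (l ^ 2 + ξ ^ 2) ≤ ξ ^ 2 / l ^ 2 := by gcongr; nlinarith
    rw [div_eq_mul_inv _ (l ^ 2)] at this
    nlinarith [sq_nonneg ξ]

lemma integral_heatMultiplier {H : ℝ} (hH : H ∈ Set.Ioo (0 : ℝ) 1) {l : ℝ} (hl : 0 < l) :
    ∫ ξ, ξ ^ 2 / (l ^ 2 + ξ ^ 2) ∂spectralMeasure H =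
      l ^ (-(2 * H)) * ∫ ξ, ξ ^ 2 / (1 ^ 2 + ξ ^ 2) ∂spectralMeasure H := by
  have h : ∀ ξ : ℝ, ξ ^ 2 / (l ^ 2 + ξ ^ 2) = (l⁻¹ * ξ) ^ 2 / (1 ^ 2 + (l⁻¹ * ξ) ^ 2) :=
    fun ξ => by field_simp
  simp_rw [h]
  rw [integral_spectralMeasure hH, integral_spectralMeasure hH,
    setIntegral_rpow_mul_comp (fun x => x ^ 2 / (1 ^ 2 + x ^ 2)) (inv_pos.2 hl),
    Real.inv_rpow hl.le, Real.rpow_neg hl.le]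
  ring

lemma le_integral_one_sub_cos_mul_heatMultiplier {H : ℝ} (hH : H ∈ Set.Ioo (0 : ℝ) 1)
    {h l m : ℝ} (hh : 0 < h) (hl : 0 ≤ l) (hm : 0 < m) (hlm : l ≤ m) (hmh : 1 ≤ m * h) :
    (4 : ℝ) ^ (-1 - 2 * H) / (4 * spectralConst H) * m ^ (-(2 * H)) ≤
      ∫ ξ, (1 - Real.cos (h * ξ)) * (ξ ^ 2 / (l ^ 2 + ξ ^ 2)) ∂spectralMeasure H := by
  rw [integral_spectralMeasure hH]
  have hc := spectralConst_pos hH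
  calc _ = (2 * spectralConst H)⁻¹ * ((4 : ℝ) ^ (-1 - 2 * H) / 2 * m ^ (-(2 * H))) := by
        field_simp; ring
    _ ≤ _ := mul_le_mul_of_nonneg_left
        (le_setIntegral_rpow_mul_one_sub_cos hH hh hl hm hlm hmh) (by positivity)

/-! ### Convergence in `L²` -/

section L2
variable {Ω E : Type*} [MeasurableSpace Ω] {μ : Measure Ω} [NormedAddCommGroup E]

lemma integral_norm_sq_eq_eLpNorm {f : Ω → E} (hf : MemLp f 2 μ) :
    ∫ ω, ‖f ω‖ ^ 2 ∂μ = (eLpNorm f 2 μ).toReal ^ 2 := by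
  rw [hf.eLpNorm_eq_integral_rpow_norm (by simp) (by simp)]
  have h0 : 0 ≤ ∫ ω, ‖f ω‖ ^ 2 ∂μ := integral_nonneg fun ω => by positivity
  simp only [ENNReal.toReal_ofNat, Real.rpow_ofNat]
  rw [ENNReal.toReal_ofReal (by positivity), ← Real.rpow_natCast, ← Real.rpow_mul h0]
  simp

lemma eLpNorm_two_eq_ofReal {f : Ω → E} (hf : MemLp f 2 μ) :
    eLpNorm f 2 μ = ENNReal.ofReal √(∫ ω, ‖f ω‖ ^ 2 ∂μ) := by
  rw [integral_norm_sq_eq_eLpNorm hf, Real.sqrt_sq ENNReal.toReal_nonneg,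
    ENNReal.ofReal_toReal hf.2.ne]

lemma tendsto_eLpNorm_of_tendsto_sub {p : ℝ≥0∞} (hp : 1 ≤ p) {f : ℕ → Ω → E} {g : Ω → E}
    (hf : ∀ k, AEStronglyMeasurable (f k) μ) (hg : AEStronglyMeasurable g μ)
    (h : Tendsto (fun k => eLpNorm (fun ω => f k ω - g ω) p μ) atTop (𝓝 0)) :
    Tendsto (fun k => eLpNorm (f k) p μ) atTop (𝓝 (eLpNorm g p μ)) := by
  have hup : Tendsto (fun k => eLpNorm g p μ + eLpNorm (fun ω => f k ω - g ω) p μ) atTop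
      (𝓝 (eLpNorm g p μ)) := by simpa using tendsto_const_nhds.add h
  have hlo : Tendsto (fun k => eLpNorm g p μ - eLpNorm (fun ω => f k ω - g ω) p μ) atTop
      (𝓝 (eLpNorm g p μ)) := by
    simpa using ENNReal.Tendsto.sub (tendsto_const_nhds (x := eLpNorm g p μ)) h (by simp)
  refine tendsto_of_tendsto_of_tendsto_of_le_of_le hlo hup (fun k => ?_) fun k => ?_
  · refine tsub_le_iff_right.2 ?_
    have := eLpNorm_sub_le (hf k) ((hf k).sub hg) hp
    rwa [sub_sub_cancel] at this
  · have := eLpNorm_add_le hg ((hf k).sub hg) hp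
    rwa [add_sub_cancel] at this

lemma tendsto_integral_norm_sq {f : ℕ → Ω → E} {g : Ω → E}
    (hf : ∀ k, MemLp (f k) 2 μ) (hg : MemLp g 2 μ)
    (h : Tendsto (fun k => eLpNorm (fun ω => f k ω - g ω) 2 μ) atTop (𝓝 0)) :
    Tendsto (fun k => ∫ ω, ‖f k ω‖ ^ 2 ∂μ) atTop (𝓝 (∫ ω, ‖g ω‖ ^ 2 ∂μ)) := by
  simp_rw [fun k => integral_norm_sq_eq_eLpNorm (hf k)]
  rw [integral_norm_sq_eq_eLpNorm hg]
  exact ((ENNReal.tendsto_toReal hg.2.ne).comp (tendsto_eLpNorm_of_tendsto_sub (by norm_num)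
    (fun k => (hf k).1) hg.1 h)).pow 2

end L2

/-! ### Spectral representation of Wiener integrals -/

/-- The spectral image `∑ₚ c(p) (e^{ipξ} - 1)` of the step function `∑ₚ c(p) 1_{[0,p]}`: its Fourier
transform multiplied by `iξ`. -/
noncomputable def stepSymbol (c : ℝ≥0 →₀ ℝ) (ξ : ℝ) : ℂ :=
  c.sum fun p a => (a : ℂ) * (Complex.exp ((p : ℝ) * ξ * Complex.I) - 1)

lemma stepSymbol_sub (c c' : ℝ≥0 →₀ ℝ) (ξ : ℝ) :
    stepSymbol (c - c') ξ = stepSymbol c ξ - stepSymbol c' ξ := by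
  unfold stepSymbol
  rw [Finsupp.sum_sub_index]
  intro a b c; push_cast; ring

lemma stepIntegral_sub {Ω : Type*} (B : ℝ≥0 → Ω → ℝ) (c c' : ℝ≥0 →₀ ℝ) (ω : Ω) :
    stepIntegral B (c - c') ω = stepIntegral B c ω - stepIntegral B c' ω := by
  unfold stepIntegral
  rw [Finsupp.sum_sub_index]
  intro a b c; ring

lemma measurable_stepSymbol (c : ℝ≥0 →₀ ℝ) : Measurable (stepSymbol c) := by
  unfold stepSymbol Finsupp.sum
  fun_prop

lemma normSq_stepSymbol (c : ℝ≥0 →₀ ℝ) (ξ : ℝ) :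
    ‖stepSymbol c ξ‖ ^ 2 = ∑ p ∈ c.support, ∑ r ∈ c.support, c p * c r *
      ((1 - Real.cos (p * ξ)) + (1 - Real.cos (r * ξ)) - (1 - Real.cos ((p - r) * ξ))) := by
  have hre : ∀ p : ℝ≥0, ((c p : ℂ) * (Complex.exp ((p : ℝ) * ξ * Complex.I) - 1)) =
      ((c p * (Real.cos (p * ξ) - 1) : ℝ) : ℂ) + ((c p * Real.sin (p * ξ) : ℝ) : ℂ) * Complex.I := by
    intro p
    rw [Complex.exp_mul_I, ← Complex.ofReal_mul, ← Complex.ofReal_cos, ← Complex.ofReal_sin]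
    push_cast; ring
  have hs : stepSymbol c ξ = ((∑ p ∈ c.support, c p * (Real.cos (p * ξ) - 1) : ℝ) : ℂ) +
      ((∑ p ∈ c.support, c p * Real.sin (p * ξ) : ℝ) : ℂ) * Complex.I := by
    unfold stepSymbol Finsupp.sum
    simp_rw [hre]
    rw [Finset.sum_add_distrib, ← Finset.sum_mul]
    push_cast; rfl
  rw [hs, ← Complex.normSq_eq_norm_sq, Complex.normSq_add_mul_I, sq, sq, Finset.sum_mul_sum,
    Finset.sum_mul_sum, ← Finset.sum_add_distrib]
  refine Finset.sum_congr rfl fun p _ => ?_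
  rw [← Finset.sum_add_distrib]
  refine Finset.sum_congr rfl fun r _ => ?_
  rw [sub_mul, Real.cos_sub]
  ring

lemma integrable_normSq_stepSymbol {H : ℝ} (hH : H ∈ Set.Ioo (0 : ℝ) 1) (c : ℝ≥0 →₀ ℝ) :
    Integrable (fun ξ => ‖stepSymbol c ξ‖ ^ 2) (spectralMeasure H) := by
  simp_rw [normSq_stepSymbol]
  refine integrable_finsetSum _ fun p _ => integrable_finsetSum _ fun r _ => ?_
  exact (((integrable_one_sub_cos hH _).add (integrable_one_sub_cos hH _)).sub
    (integrable_one_sub_cos hH _)).const_mul _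

lemma memLp_stepSymbol {H : ℝ} (hH : H ∈ Set.Ioo (0 : ℝ) 1) (c : ℝ≥0 →₀ ℝ) :
    MemLp (stepSymbol c) 2 (spectralMeasure H) :=
  (memLp_two_iff_integrable_sq_norm (measurable_stepSymbol c).aestronglyMeasurable).2
    (integrable_normSq_stepSymbol hH c)

section Wiener
variable {Ω : Type*} [MeasurableSpace Ω] {μ : Measure Ω} {H : ℝ} {B : ℝ≥0 → Ω → ℝ}

lemma memLp_stepIntegral (hB : IsFractionalBM H B μ) (c : ℝ≥0 →₀ ℝ) :
    MemLp (stepIntegral B c) 2 μ := by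
  have : stepIntegral B c = fun ω => ∑ p ∈ c.support, c p * B p ω := rfl
  rw [this]
  exact memLp_finsetSum _ fun p _ => (hB.gaussian.hasGaussianLaw_eval p).memLp_two.const_mul _

/-- The covariance of fractional Brownian motion is a scalar product in the spectral domain. -/
lemma integral_stepIntegral_sq (hH : H ∈ Set.Ioo (0 : ℝ) 1) (hB : IsFractionalBM H B μ)
    (c : ℝ≥0 →₀ ℝ) :
    ∫ ω, ‖stepIntegral B c ω‖ ^ 2 ∂μ = ∫ ξ, ‖stepSymbol c ξ‖ ^ 2 ∂spectralMeasure H := by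
  have hB2 : ∀ p, MemLp (B p) 2 μ := fun p => (hB.gaussian.hasGaussianLaw_eval p).memLp_two
  have hi : ∀ p r, Integrable (fun ω => B p ω * B r ω) μ := fun p r =>
    (hB2 p).integrable_mul (hB2 r)
  have hl : ∀ ω, ‖stepIntegral B c ω‖ ^ 2 =
      ∑ p ∈ c.support, ∑ r ∈ c.support, c p * c r * (B p ω * B r ω) := fun ω => by
    rw [Real.norm_eq_abs, sq_abs, stepIntegral, Finsupp.sum, sq, Finset.sum_mul_sum]
    exact Finset.sum_congr rfl fun p _ => Finset.sum_congr rfl fun r _ => by ring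
  simp_rw [hl, normSq_stepSymbol]
  have hcos := integrable_one_sub_cos hH
  have hcos3 : ∀ p r : ℝ≥0, Integrable (fun ξ : ℝ => c p * c r *
      ((1 - Real.cos (p * ξ)) + (1 - Real.cos (r * ξ)) - (1 - Real.cos ((p - r) * ξ))))
      (spectralMeasure H) := fun p r =>
    (((hcos _).add (hcos _)).sub (hcos _)).const_mul _
  rw [integral_finsetSum _ fun p _ => integrable_finsetSum _ fun r _ => (hi p r).const_mul _,
    integral_finsetSum _ fun p _ => integrable_finsetSum _ fun r _ =>
      hcos3 p r]
  refine Finset.sum_congr rfl fun p _ => ?_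
  rw [integral_finsetSum _ fun r _ => (hi p r).const_mul _, integral_finsetSum _ fun r _ => hcos3 p r]
  refine Finset.sum_congr rfl fun r _ => ?_
  have hadd : Integrable (fun ξ : ℝ => (1 - Real.cos (p * ξ)) + (1 - Real.cos (r * ξ)))
      (spectralMeasure H) := (hcos _).add (hcos _)
  rw [integral_const_mul, integral_const_mul, hB.covariance, integral_sub hadd (hcos _), integral_add (hcos _) (hcos _),
    integral_one_sub_cos hH, integral_one_sub_cos hH, integral_one_sub_cos hH,
    abs_of_nonneg p.coe_nonneg, abs_of_nonneg r.coe_nonneg]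
  ring

lemma eLpNorm_stepIntegral (hH : H ∈ Set.Ioo (0 : ℝ) 1) (hB : IsFractionalBM H B μ)
    (c : ℝ≥0 →₀ ℝ) :
    eLpNorm (stepIntegral B c) 2 μ = eLpNorm (stepSymbol c) 2 (spectralMeasure H) := by
  rw [eLpNorm_two_eq_ofReal (memLp_stepIntegral hB c), integral_stepIntegral_sq hH hB,
    ← eLpNorm_two_eq_ofReal (memLp_stepSymbol hH c)]

/-- If elementary integrals converge in `L²` and the symbols of their step functions converge
pointwise, then the symbols converge in `L²` of the spectral measure. The proof bounds
`‖F k - Φ‖` by `liminf ‖F k - F j‖` (Fatou) and transports this to the elementary integrals. -/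
lemma tendsto_eLpNorm_stepSymbol_sub (hH : H ∈ Set.Ioo (0 : ℝ) 1) (hB : IsFractionalBM H B μ)
    {c : ℕ → (ℝ≥0 →₀ ℝ)} {Z : Ω → ℝ} {Φ : ℝ → ℂ} (hZ : MemLp Z 2 μ)
    (hcZ : Tendsto (fun k => eLpNorm (fun ω => stepIntegral B (c k) ω - Z ω) 2 μ) atTop (𝓝 0))
    (hcΦ : ∀ ξ, Tendsto (fun k => stepSymbol (c k) ξ) atTop (𝓝 (Φ ξ))) :
    Tendsto (fun k => eLpNorm (fun ξ => stepSymbol (c k) ξ - Φ ξ) 2 (spectralMeasure H))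
      atTop (𝓝 0) := by
  refine tendsto_of_tendsto_of_tendsto_of_le_of_le tendsto_const_nhds hcZ
    (fun _ => zero_le) fun k => ?_
  have hfatou := Lp.eLpNorm_lim_le_liminf_eLpNorm (p := 2) (μ := spectralMeasure H)
    (f := fun j ξ => stepSymbol (c k) ξ - stepSymbol (c j) ξ)
    (fun j => ((measurable_stepSymbol _).sub (measurable_stepSymbol _)).aestronglyMeasurable)
    (fun ξ => stepSymbol (c k) ξ - Φ ξ)
    (Eventually.of_forall fun ξ => tendsto_const_nhds.sub (hcΦ ξ))
  refine hfatou.trans ?_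
  have hlim : Tendsto (fun j => eLpNorm (fun ω => stepIntegral B (c k) ω - Z ω) 2 μ +
      eLpNorm (fun ω => stepIntegral B (c j) ω - Z ω) 2 μ) atTop
      (𝓝 (eLpNorm (fun ω => stepIntegral B (c k) ω - Z ω) 2 μ)) := by
    simpa using tendsto_const_nhds.add hcZ
  rw [← hlim.liminf_eq]
  refine liminf_le_liminf (Eventually.of_forall fun j => ?_)
  have h1 : (fun ξ => stepSymbol (c k) ξ - stepSymbol (c j) ξ) = stepSymbol (c k - c j) :=
    funext fun ξ => (stepSymbol_sub _ _ ξ).symm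
  have h2 : stepIntegral B (c k - c j) =
      (fun ω => stepIntegral B (c k) ω - Z ω) - fun ω => stepIntegral B (c j) ω - Z ω :=
    funext fun ω => by simp [stepIntegral_sub]
  simp only [h1]
  rw [← eLpNorm_stepIntegral hH hB, h2]
  exact eLpNorm_sub_le ((memLp_stepIntegral hB _).sub hZ).1 ((memLp_stepIntegral hB _).sub hZ).1
    (by norm_num)

end Wiener

/-- The spectral image of the kernel `s ↦ e^{-l(t-s)}` on `[0,t]`: its Fourier transform multiplied
by `iξ`. -/
noncomputable def heatSymbol (l t ξ : ℝ) : ℂ :=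
  ξ * Complex.I * ((Complex.exp (t * ξ * Complex.I) - Real.exp (-l * t)) / (l + ξ * Complex.I))

lemma integral_exp_mul_heatKernel {l ξ : ℝ} (hξ : ξ ≠ 0) (t : ℝ) :
    ∫ s in (0 : ℝ)..t, ((Real.exp (-l * (t - s)) : ℝ) : ℂ) * Complex.exp (s * ξ * Complex.I) =
      (Complex.exp (t * ξ * Complex.I) - Real.exp (-l * t)) / (l + ξ * Complex.I) := by
  have hne : (l + ξ * Complex.I : ℂ) ≠ 0 := fun h => hξ (by simpa using congrArg Complex.im h)
  have h : ∀ s : ℝ, ((Real.exp (-l * (t - s)) : ℝ) : ℂ) * Complex.exp (s * ξ * Complex.I) =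
      (Real.exp (-l * t) : ℂ) * Complex.exp ((l + ξ * Complex.I) * s) := fun s => by
    push_cast
    rw [← Complex.exp_add, ← Complex.exp_add]; congr 1; ring
  simp_rw [h]
  rw [intervalIntegral.integral_const_mul, integral_exp_mul_complex hne, mul_div_assoc']
  congr 1
  push_cast
  rw [mul_sub, ← Complex.exp_add]
  simp
  ring_nf

/-- `e^{ipξ} - 1` as an integral over `[0,t]`, for `p ≤ t`. -/
lemma exp_sub_one_eq_integral_indicator {p t : ℝ≥0} (hp : p ≤ t) (ξ : ℝ) :
    IntervalIntegrable (fun s : ℝ => (((Set.Icc 0 p).indicator (fun _ => (1 : ℝ)) s.toNNReal : ℝ) : ℂ)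
        * Complex.exp (s * ξ * Complex.I)) volume 0 t ∧
    Complex.exp ((p : ℝ) * ξ * Complex.I) - 1 = ξ * Complex.I *
      ∫ s in (0 : ℝ)..t, (((Set.Icc 0 p).indicator (fun _ => (1 : ℝ)) s.toNNReal : ℝ) : ℂ) *
        Complex.exp (s * ξ * Complex.I) := by
  have hpt : (p : ℝ) ≤ t := hp
  have hfun : Set.EqOn (fun s : ℝ => (((Set.Icc 0 p).indicator (fun _ => (1 : ℝ)) s.toNNReal : ℝ) : ℂ)
      * Complex.exp (s * ξ * Complex.I))
      ((Set.Ioc (0 : ℝ) p).indicator fun s : ℝ => Complex.exp (s * ξ * Complex.I))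
      (Set.Ioc (0 : ℝ) t) := fun s hs => by
    by_cases h : s ≤ p
    · have h1 : s.toNNReal ∈ Set.Icc 0 p := ⟨zero_le, Real.toNNReal_le_iff_le_coe.2 h⟩
      have h2 : s ∈ Set.Ioc (0 : ℝ) p := ⟨hs.1, h⟩
      simp only [Set.indicator_of_mem h1, Set.indicator_of_mem h2]; simp
    · have h1 : s.toNNReal ∉ Set.Icc 0 p := fun h' => h (Real.toNNReal_le_iff_le_coe.1 h'.2)
      have h2 : s ∉ Set.Ioc (0 : ℝ) p := fun h' => h h'.2
      simp only [Set.indicator_of_notMem h1, Set.indicator_of_notMem h2]; simp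
  have hcont : Continuous fun s : ℝ => Complex.exp (s * ξ * Complex.I) := by fun_prop
  constructor
  · rw [intervalIntegrable_iff_integrableOn_Ioc_of_le t.coe_nonneg]
    refine IntegrableOn.congr_fun ?_ hfun.symm measurableSet_Ioc
    exact (hcont.integrableOn_Icc.mono_set Set.Ioc_subset_Icc_self).indicator measurableSet_Ioc
  · rw [intervalIntegral.integral_of_le t.coe_nonneg, setIntegral_congr_fun measurableSet_Ioc hfun,
      setIntegral_indicator measurableSet_Ioc, Set.Ioc_inter_Ioc, sup_idem, min_eq_right hpt,
      ← intervalIntegral.integral_of_le p.coe_nonneg]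
    rcases eq_or_ne ξ 0 with rfl | hξ
    · simp
    have hne : (ξ * Complex.I : ℂ) ≠ 0 := mul_ne_zero (by exact_mod_cast hξ) Complex.I_ne_zero
    have h : ∀ s : ℝ, Complex.exp (s * ξ * Complex.I) = Complex.exp ((ξ * Complex.I) * s) :=
      fun s => by congr 1; ring
    simp_rw [h]
    rw [integral_exp_mul_complex hne, mul_div_cancel₀ _ hne]
    simp

lemma stepSymbol_eq_integral {c : ℝ≥0 →₀ ℝ} {t : ℝ≥0} (hc : ∀ p ∈ c.support, p ≤ t) (ξ : ℝ) :
    IntervalIntegrable (fun s : ℝ => ((stepFunction c s.toNNReal : ℝ) : ℂ)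
        * Complex.exp (s * ξ * Complex.I)) volume 0 t ∧
    stepSymbol c ξ = ξ * Complex.I *
      ∫ s in (0 : ℝ)..t, ((stepFunction c s.toNNReal : ℝ) : ℂ) *
        Complex.exp (s * ξ * Complex.I) := by
  have hfun : ∀ s : ℝ, ((stepFunction c s.toNNReal : ℝ) : ℂ) * Complex.exp (s * ξ * Complex.I) =
      ∑ p ∈ c.support, (c p : ℂ) * ((((Set.Icc 0 p).indicator (fun _ => (1 : ℝ)) s.toNNReal : ℝ) : ℂ) *
        Complex.exp (s * ξ * Complex.I)) := fun s => by
    simp only [stepFunction, Finsupp.sum]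
    rw [Complex.ofReal_sum, Finset.sum_mul]
    exact Finset.sum_congr rfl fun p _ => by rw [Complex.ofReal_mul, mul_assoc]
  simp_rw [hfun]
  have hi := fun p (hp : p ∈ c.support) =>
    (exp_sub_one_eq_integral_indicator (hc p hp) ξ).1.const_mul (c p : ℂ)
  refine ⟨by simpa [Finset.sum_fn] using IntervalIntegrable.sum _ hi, ?_⟩
  rw [intervalIntegral.integral_finsetSum hi, Finset.mul_sum, stepSymbol, Finsupp.sum]
  refine Finset.sum_congr rfl fun p hp => ?_
  rw [intervalIntegral.integral_const_mul, (exp_sub_one_eq_integral_indicator (hc p hp) ξ).2]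
  ring

lemma tendsto_stepSymbol_heatSymbol {l : ℝ} {t : ℝ≥0} {c : ℕ → (ℝ≥0 →₀ ℝ)}
    (hc : ∀ k, ∀ p ∈ (c k).support, p ≤ t)
    (hu : TendstoUniformlyOn (fun k => stepFunction (c k))
      (fun s : ℝ≥0 => Real.exp (-l * ((t : ℝ) - s))) atTop (Set.Icc 0 t)) (ξ : ℝ) :
    Tendsto (fun k => stepSymbol (c k) ξ) atTop (𝓝 (heatSymbol l t ξ)) := by
  rcases eq_or_ne ξ 0 with rfl | hξ
  · simp [stepSymbol, heatSymbol]
  rw [heatSymbol, ← integral_exp_mul_heatKernel hξ]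
  simp_rw [fun k => (stepSymbol_eq_integral (hc k) ξ).2]
  refine Tendsto.const_mul _ ?_
  rw [Metric.tendsto_atTop]
  intro ε hε
  have hpos : 0 < ε / (t + 1) := div_pos hε (by positivity)
  obtain ⟨N, hN⟩ := eventually_atTop.1 (Metric.tendstoUniformlyOn_iff.1 hu _ hpos)
  refine ⟨N, fun k hk => ?_⟩
  have hcont : Continuous fun s : ℝ =>
      ((Real.exp (-l * (t - s)) : ℝ) : ℂ) * Complex.exp (s * ξ * Complex.I) := by fun_prop
  rw [dist_eq_norm, ← intervalIntegral.integral_sub (stepSymbol_eq_integral (hc k) ξ).1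
    (hcont.intervalIntegrable _ _)]
  have hb : ∀ s ∈ Set.uIoc (0 : ℝ) t, ‖((stepFunction (c k) s.toNNReal : ℝ) : ℂ) *
      Complex.exp (s * ξ * Complex.I) - ((Real.exp (-l * (t - s)) : ℝ) : ℂ) *
      Complex.exp (s * ξ * Complex.I)‖ ≤ ε / (t + 1) := fun s hs => by
    rw [Set.uIoc_of_le t.coe_nonneg] at hs
    have h1 := hN k hk s.toNNReal ⟨zero_le, Real.toNNReal_le_iff_le_coe.2 hs.2⟩
    have h2 : ‖Complex.exp (s * ξ * Complex.I)‖ = 1 := by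
      rw [← Complex.ofReal_mul]; exact Complex.norm_exp_ofReal_mul_I _
    rw [← sub_mul, norm_mul, h2, mul_one, ← Complex.ofReal_sub, Complex.norm_real, ← dist_eq_norm,
      dist_comm]
    rw [Real.coe_toNNReal _ hs.1.le] at h1
    exact h1.le
  refine (intervalIntegral.norm_integral_le_of_norm_le_const hb).trans_lt ?_
  rw [sub_zero, abs_of_nonneg t.coe_nonneg, div_mul_eq_mul_div, div_lt_iff₀ (by positivity)]
  nlinarith [t.2]

/-- Increments of the stochastic convolution are `L²`-limits of elementary integrals whose symbols
converge to the increment of `heatSymbol`. -/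
lemma exists_stepIntegral_tendsto_sub {Ω : Type*} [MeasurableSpace Ω] {μ : Measure Ω} {H : ℝ}
    {B : ℝ≥0 → Ω → ℝ} (hB : IsFractionalBM H B μ) {l : ℝ} {s t : ℝ≥0} {X Y : Ω → ℝ}
    (hX : IsWienerIntegral B μ t (fun r => Real.exp (-l * ((t : ℝ) - r))) X)
    (hY : IsWienerIntegral B μ s (fun r => Real.exp (-l * ((s : ℝ) - r))) Y) :
    ∃ c : ℕ → (ℝ≥0 →₀ ℝ),
      Tendsto (fun k => eLpNorm (fun ω => stepIntegral B (c k) ω - (X ω - Y ω)) 2 μ)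
        atTop (𝓝 0) ∧
      ∀ ξ, Tendsto (fun k => stepSymbol (c k) ξ) atTop
        (𝓝 (heatSymbol l t ξ - heatSymbol l s ξ)) := by
  obtain ⟨hX2, c, hc, hcu, hcX⟩ := hX
  obtain ⟨hY2, c', hc', hcu', hcY⟩ := hY
  refine ⟨fun k => c k - c' k, ?_, fun ξ => ?_⟩
  · have h0 := hcX.add hcY
    rw [add_zero] at h0
    refine tendsto_of_tendsto_of_tendsto_of_le_of_le tendsto_const_nhds h0
      (fun _ => zero_le) fun k => ?_
    refine le_of_eq_of_le ?_ (eLpNorm_sub_le ((memLp_stepIntegral hB (c k)).sub hX2).1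
      ((memLp_stepIntegral hB (c' k)).sub hY2).1 (by norm_num))
    congr 1
    ext ω
    simp [stepIntegral_sub]; ring
  · simp_rw [stepSymbol_sub]
    exact (tendsto_stepSymbol_heatSymbol hc hcu ξ).sub (tendsto_stepSymbol_heatSymbol hc' hcu' ξ)

/-! ### Sub-Gaussian bounds with the exact variance -/

/-- A random variable that is sub-Gaussian with variance proxy equal to its second moment. Centred
Gaussian variables have this property, and it is stable under limits in `L²`, so that it replaces
Gaussianity in the tail estimates. -/
def IsStrictlySubgaussian {Ω : Type*} [MeasurableSpace Ω] (Z : Ω → ℝ) (μ : Measure Ω) : Prop :=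
  MemLp Z 2 μ ∧ HasSubgaussianMGF Z (∫ ω, ‖Z ω‖ ^ 2 ∂μ).toNNReal μ

section Subgaussian
variable {Ω : Type*} [MeasurableSpace Ω] {μ : Measure Ω}

lemma IsStrictlySubgaussian.of_tendsto {f : ℕ → Ω → ℝ} {g : Ω → ℝ}
    (hf : ∀ k, IsStrictlySubgaussian (f k) μ) (hg : MemLp g 2 μ)
    (h : Tendsto (fun k => eLpNorm (fun ω => f k ω - g ω) 2 μ) atTop (𝓝 0)) :
    IsStrictlySubgaussian g μ := by
  obtain ⟨φ, hφ, hae⟩ := (tendstoInMeasure_of_tendsto_eLpNorm (by norm_num)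
    (fun k => (hf k).1.1) hg.1 h).exists_seq_tendsto_ae
  have hsq := (tendsto_integral_norm_sq (fun k => (hf k).1) hg h).comp hφ.tendsto_atTop
  -- Fatou's lemma along an almost surely convergent subsequence
  have hle : ∀ t : ℝ, ∫⁻ ω, ENNReal.ofReal (Real.exp (t * g ω)) ∂μ ≤
      ENNReal.ofReal (Real.exp ((∫ ω, ‖g ω‖ ^ 2 ∂μ) * t ^ 2 / 2)) := fun t => by
    have hbound : ∀ k, ∫⁻ ω, ENNReal.ofReal (Real.exp (t * f (φ k) ω)) ∂μ ≤
        ENNReal.ofReal (Real.exp ((∫ ω, ‖f (φ k) ω‖ ^ 2 ∂μ) * t ^ 2 / 2)) := fun k => by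
      have hk := (hf (φ k)).2
      rw [← ofReal_integral_eq_lintegral_ofReal (hk.integrable_exp_mul t)
        (Eventually.of_forall fun ω => (Real.exp_pos _).le)]
      refine ENNReal.ofReal_le_ofReal ((hk.mgf_le t).trans_eq ?_)
      rw [Real.coe_toNNReal _ (integral_nonneg fun ω => by positivity)]
    calc ∫⁻ ω, ENNReal.ofReal (Real.exp (t * g ω)) ∂μ
        = ∫⁻ ω, liminf (fun k => ENNReal.ofReal (Real.exp (t * f (φ k) ω))) atTop ∂μ := by
          refine lintegral_congr_ae (hae.mono fun ω hω => ?_)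
          refine (Tendsto.liminf_eq ?_).symm
          exact ENNReal.tendsto_ofReal ((Real.continuous_exp.tendsto _).comp (hω.const_mul t))
      _ ≤ liminf (fun k => ∫⁻ ω, ENNReal.ofReal (Real.exp (t * f (φ k) ω)) ∂μ) atTop :=
          lintegral_liminf_le' fun k => (Real.measurable_exp.comp_aemeasurable
            ((hf (φ k)).1.1.aemeasurable.const_mul t)).ennreal_ofReal
      _ ≤ liminf (fun k => ENNReal.ofReal
            (Real.exp ((∫ ω, ‖f (φ k) ω‖ ^ 2 ∂μ) * t ^ 2 / 2))) atTop :=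
          liminf_le_liminf (Eventually.of_forall hbound)
      _ = _ := by
          refine Tendsto.liminf_eq (ENNReal.tendsto_ofReal ((Real.continuous_exp.tendsto _).comp ?_))
          exact (hsq.mul_const (t ^ 2)).div_const 2
  have hint : ∀ t : ℝ, Integrable (fun ω => Real.exp (t * g ω)) μ := fun t => by
    refine ⟨(Real.measurable_exp.comp_aemeasurable
      (hg.1.aemeasurable.const_mul t)).aestronglyMeasurable, ?_⟩
    rw [hasFiniteIntegral_iff_ofReal (Eventually.of_forall fun ω => (Real.exp_pos _).le)]
    exact (hle t).trans_lt ENNReal.ofReal_lt_top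
  refine ⟨hg, hint, fun t => ?_⟩
  have h1 := hle t
  rw [← ofReal_integral_eq_lintegral_ofReal (hint t)
    (Eventually.of_forall fun ω => (Real.exp_pos _).le),
    ENNReal.ofReal_le_ofReal_iff (Real.exp_pos _).le] at h1
  rwa [Real.coe_toNNReal _ (integral_nonneg fun ω => by positivity)]

lemma IsStrictlySubgaussian.measure_abs_ge_le [IsFiniteMeasure μ] {Z : Ω → ℝ}
    (hZ : IsStrictlySubgaussian Z μ) {v : ℝ} (hv : 0 < v)
    (hle : ∫ ω, ‖Z ω‖ ^ 2 ∂μ ≤ v) {r : ℝ} (hr : 0 ≤ r) :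
    μ {ω | r ≤ |Z ω|} ≤ ENNReal.ofReal (2 * Real.exp (-r ^ 2 / (2 * v))) := by
  have hZv : HasSubgaussianMGF Z v.toNNReal μ := by
    refine ⟨hZ.2.integrable_exp_mul, fun t => (hZ.2.mgf_le t).trans ?_⟩
    rw [Real.coe_toNNReal _ (integral_nonneg fun ω => by positivity), Real.coe_toNNReal _ hv.le]
    gcongr
  have h1 := hZv.measure_ge_le hr
  have h2 := hZv.neg.measure_ge_le hr
  rw [Real.coe_toNNReal _ hv.le] at h1 h2
  have hsub : {ω | r ≤ |Z ω|} ⊆ {ω | r ≤ Z ω} ∪ {ω | r ≤ (-Z) ω} :=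
    fun ω (hω : r ≤ |Z ω|) => le_abs.1 hω
  refine (measure_mono hsub).trans ?_
  rw [← ofReal_measureReal]
  refine ENNReal.ofReal_le_ofReal ((measureReal_union_le _ _).trans ?_)
  rw [two_mul]
  exact add_le_add h1 h2

variable [IsProbabilityMeasure μ] {H : ℝ}

lemma integral_stepIntegral {B : ℝ≥0 → Ω → ℝ} (hB : IsFractionalBM H B μ) (c : ℝ≥0 →₀ ℝ) :
    ∫ ω, stepIntegral B c ω ∂μ = 0 := by
  unfold stepIntegral Finsupp.sum
  rw [integral_finsetSum _ fun p _ =>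
    ((hB.gaussian.hasGaussianLaw_eval p).memLp_two.integrable (by norm_num)).const_mul _]
  refine Finset.sum_eq_zero fun p _ => ?_
  rw [integral_const_mul, hB.centered, mul_zero]

lemma isStrictlySubgaussian_stepIntegral {B : ℝ≥0 → Ω → ℝ} (hB : IsFractionalBM H B μ)
    (c : ℝ≥0 →₀ ℝ) : IsStrictlySubgaussian (stepIntegral B c) μ := by
  have hg : HasGaussianLaw (stepIntegral B c) μ :=
    (hB.gaussian.smul c).hasGaussianLaw_fun_sum (I := c.support)
  have hm := memLp_stepIntegral hB c
  have hmap := hg.map_eq_gaussianReal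
  have hvar : Var[stepIntegral B c; μ] = ∫ ω, ‖stepIntegral B c ω‖ ^ 2 ∂μ := by
    rw [variance_of_integral_eq_zero hm.1.aemeasurable (integral_stepIntegral hB c)]
    simp [sq_abs]
  rw [integral_stepIntegral hB, hvar] at hmap
  refine ⟨hm, fun t => ?_, fun t => ?_⟩
  · have h := integrable_exp_mul_gaussianReal (μ := 0)
      (v := (∫ ω, ‖stepIntegral B c ω‖ ^ 2 ∂μ).toNNReal) t
    rw [← hmap] at h
    exact h.comp_aemeasurable hm.1.aemeasurable
  · rw [mgf_gaussianReal hmap]; simp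

variable {ι : Type*} {B : ι → ℝ≥0 → Ω → ℝ}

/-- A linear combination of elementary integrals against independent fractional Brownian motions is
strictly sub-Gaussian, with its variance given by the spectral measure. -/
lemma isStrictlySubgaussian_sum_stepIntegral (hH : H ∈ Set.Ioo (0 : ℝ) 1)
    (hB : ∀ j, IsFractionalBM H (B j) μ)
    (hind : iIndepFun (fun j ω (t : ℝ≥0) => B j t ω) μ) (J : Finset ι) (w : ι → ℝ)
    (c : ι → (ℝ≥0 →₀ ℝ)) :
    IsStrictlySubgaussian (fun ω => ∑ j ∈ J, w j * stepIntegral (B j) (c j) ω) μ ∧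
    ∫ ω, ‖∑ j ∈ J, w j * stepIntegral (B j) (c j) ω‖ ^ 2 ∂μ =
      ∑ j ∈ J, w j ^ 2 * ∫ ξ, ‖stepSymbol (c j) ξ‖ ^ 2 ∂spectralMeasure H := by
  have hm : ∀ j, MemLp (fun ω => w j * stepIntegral (B j) (c j) ω) 2 μ := fun j =>
    (memLp_stepIntegral (hB j) (c j)).const_mul _
  have hindS : iIndepFun (fun j ω => w j * stepIntegral (B j) (c j) ω) μ := by
    refine hind.comp (fun j (x : ℝ≥0 → ℝ) => w j * (c j).sum fun p a => a * x p) fun j => ?_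
    unfold Finsupp.sum
    fun_prop
  have hsq : ∫ ω, ‖∑ j ∈ J, w j * stepIntegral (B j) (c j) ω‖ ^ 2 ∂μ =
      ∑ j ∈ J, w j ^ 2 * ∫ ξ, ‖stepSymbol (c j) ξ‖ ^ 2 ∂spectralMeasure H := by
    have h0 : ∀ j, ∫ ω, w j * stepIntegral (B j) (c j) ω ∂μ = 0 := fun j => by
      rw [integral_const_mul, integral_stepIntegral (hB j), mul_zero]
    have hv := IndepFun.variance_sum (X := fun j ω => w j * stepIntegral (B j) (c j) ω) (s := J)
      (fun j _ => hm j) (fun i _ j _ hij => hindS.indepFun hij)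
    rw [Finset.sum_fn, variance_of_integral_eq_zero
      (memLp_finsetSum J fun j _ => hm j).1.aemeasurable] at hv
    · simp only [Real.norm_eq_abs, sq_abs]
      rw [hv]
      refine Finset.sum_congr rfl fun j _ => ?_
      rw [variance_of_integral_eq_zero (hm j).1.aemeasurable (h0 j),
        ← integral_stepIntegral_sq hH (hB j), ← integral_const_mul]
      simp [mul_pow]
    · rw [integral_finsetSum _ fun j _ => (hm j).integrable (by norm_num)]
      exact Finset.sum_eq_zero fun j _ => h0 j
  refine ⟨⟨memLp_finsetSum J fun j _ => hm j, ?_⟩, hsq⟩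
  have hsub := HasSubgaussianMGF.sum_of_iIndepFun hindS (s := J) fun j _ =>
    (isStrictlySubgaussian_stepIntegral (hB j) (c j)).2.const_mul (w j)
  convert hsub using 1
  rw [hsq]
  ext
  rw [Real.coe_toNNReal _ (Finset.sum_nonneg fun j _ =>
    mul_nonneg (sq_nonneg _) (integral_nonneg fun ω => by positivity)), NNReal.coe_sum]
  refine Finset.sum_congr rfl fun j _ => ?_
  change _ = w j ^ 2 * ((∫ ω, ‖stepIntegral (B j) (c j) ω‖ ^ 2 ∂μ).toNNReal : ℝ)
  rw [Real.coe_toNNReal _ (integral_nonneg fun ω => by positivity),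
    integral_stepIntegral_sq hH (hB j)]

/-- The spectral isometry for finite sums of limits of elementary integrals against independent fractional
Brownian motions. -/
lemma isStrictlySubgaussian_sum_of_tendsto (hH : H ∈ Set.Ioo (0 : ℝ) 1)
    (hB : ∀ j, IsFractionalBM H (B j) μ)
    (hind : iIndepFun (fun j ω (t : ℝ≥0) => B j t ω) μ) (J : Finset ι) (w : ι → ℝ)
    {c : ι → ℕ → (ℝ≥0 →₀ ℝ)} {D : ι → Ω → ℝ} {Ψ : ι → ℝ → ℂ} (hD : ∀ j, MemLp (D j) 2 μ)
    (hcD : ∀ j, Tendsto (fun k => eLpNorm (fun ω => stepIntegral (B j) (c j k) ω - D j ω) 2 μ)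
      atTop (𝓝 0))
    (hcΨ : ∀ j ξ, Tendsto (fun k => stepSymbol (c j k) ξ) atTop (𝓝 (Ψ j ξ))) :
    IsStrictlySubgaussian (fun ω => ∑ j ∈ J, w j * D j ω) μ ∧
    ∫ ω, ‖∑ j ∈ J, w j * D j ω‖ ^ 2 ∂μ =
      ∑ j ∈ J, w j ^ 2 * ∫ ξ, ‖Ψ j ξ‖ ^ 2 ∂spectralMeasure H := by
  have hmem : MemLp (fun ω => ∑ j ∈ J, w j * D j ω) 2 μ :=
    memLp_finsetSum J fun j _ => (hD j).const_mul _
  have hstep := fun k => isStrictlySubgaussian_sum_stepIntegral hH hB hind J w fun j => c j k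
  have htend : Tendsto (fun k => eLpNorm (fun ω => (∑ j ∈ J, w j * stepIntegral (B j) (c j k) ω) -
      ∑ j ∈ J, w j * D j ω) 2 μ) atTop (𝓝 0) := by
    have h0 : Tendsto (fun k => ∑ j ∈ J, ‖w j‖ₑ *
        eLpNorm (fun ω => stepIntegral (B j) (c j k) ω - D j ω) 2 μ) atTop (𝓝 0) := by
      have := tendsto_finsetSum J fun j _ =>
        ENNReal.Tendsto.const_mul (a := ‖w j‖ₑ) (hcD j) (Or.inr (by simp))
      simpa using this
    refine tendsto_of_tendsto_of_tendsto_of_le_of_le tendsto_const_nhds h0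
      (fun _ => zero_le) fun k => ?_
    have hm : ∀ j ∈ J, AEStronglyMeasurable
        (w j • fun ω => stepIntegral (B j) (c j k) ω - D j ω) μ :=
      fun j _ => (((memLp_stepIntegral (hB j) (c j k)).sub (hD j)).const_smul (w j)).1
    refine le_of_eq_of_le ?_ ((eLpNorm_sum_le hm (by norm_num)).trans_eq
      (Finset.sum_congr rfl fun j _ => eLpNorm_const_smul _ _ _ _))
    congr 1
    ext ω
    rw [Finset.sum_apply, ← Finset.sum_sub_distrib]
    exact Finset.sum_congr rfl fun j _ => by simp [mul_sub]
  refine ⟨IsStrictlySubgaussian.of_tendsto (fun k => (hstep k).1) hmem htend, ?_⟩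
  have h1 := tendsto_integral_norm_sq (fun k => (hstep k).1.1) hmem htend
  simp_rw [fun k => (hstep k).2] at h1
  refine tendsto_nhds_unique h1 (tendsto_finsetSum J fun j _ => Tendsto.const_mul _ ?_)
  have h2 := tendsto_eLpNorm_stepSymbol_sub hH (hB j) (hD j) (hcD j) (hcΨ j)
  -- measurability and square integrability of `Ψ j` are inherited from the approximating symbols
  have hΨm : AEStronglyMeasurable (Ψ j) (spectralMeasure H) :=
    (measurable_of_tendsto_metrizable (fun k => measurable_stepSymbol (c j k))
      (tendsto_pi_nhds.2 (hcΨ j))).aestronglyMeasurable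
  obtain ⟨k, hk⟩ := (h2.eventually (gt_mem_nhds ENNReal.zero_lt_top)).exists
  have hΨ : MemLp (Ψ j) 2 (spectralMeasure H) := by
    have hsub : MemLp (fun ξ => stepSymbol (c j k) ξ - Ψ j ξ) 2 (spectralMeasure H) :=
      ⟨(measurable_stepSymbol _).aestronglyMeasurable.sub hΨm, hk⟩
    convert (memLp_stepSymbol hH (c j k)).sub hsub using 1
    ext ξ; simp
  exact tendsto_integral_norm_sq (fun k => memLp_stepSymbol hH (c j k)) hΨ h2

end Subgaussian

/-! ### The variance of the increments of one Fourier mode -/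

/-- The variance of `I_t - I_s`, where `I_t = ∫₀ᵗ e^{-l(t-r)} B(dr)`, in spectral form. -/
noncomputable def incrementVar (H l s t : ℝ) : ℝ :=
  ∫ ξ, ‖heatSymbol l t ξ - heatSymbol l s ξ‖ ^ 2 ∂spectralMeasure H

lemma incrementVar_nonneg (H l s t : ℝ) : 0 ≤ incrementVar H l s t :=
  integral_nonneg fun _ => by positivity

lemma normSq_heatSymbol_sub (l s t ξ : ℝ) :
    ‖heatSymbol l t ξ - heatSymbol l s ξ‖ ^ 2 =
      ‖Complex.exp (t * ξ * Complex.I) - Complex.exp (s * ξ * Complex.I) -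
        ((Real.exp (-l * t) - Real.exp (-l * s) : ℝ) : ℂ)‖ ^ 2 * (ξ ^ 2 / (l ^ 2 + ξ ^ 2)) := by
  have h : heatSymbol l t ξ - heatSymbol l s ξ =
      (Complex.exp (t * ξ * Complex.I) - Complex.exp (s * ξ * Complex.I) -
        ((Real.exp (-l * t) - Real.exp (-l * s) : ℝ) : ℂ)) *
        (ξ * Complex.I / (l + ξ * Complex.I)) := by
    unfold heatSymbol; push_cast; ring
  rw [h, norm_mul, mul_pow, norm_div, div_pow]
  congr 2
  · simp
  · rw [← Complex.normSq_eq_norm_sq, Complex.normSq_add_mul_I]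

lemma normSq_exp_sub_exp (s t ξ : ℝ) :
    ‖Complex.exp (t * ξ * Complex.I) - Complex.exp (s * ξ * Complex.I)‖ ^ 2 =
      2 * (1 - Real.cos (|t - s| * ξ)) := by
  have h : Complex.exp (t * ξ * Complex.I) - Complex.exp (s * ξ * Complex.I) =
      ((Real.cos (t * ξ) - Real.cos (s * ξ) : ℝ) : ℂ) +
        ((Real.sin (t * ξ) - Real.sin (s * ξ) : ℝ) : ℂ) * Complex.I := by
    rw [Complex.exp_mul_I, Complex.exp_mul_I]; push_cast; ring
  have hc : Real.cos (|t - s| * ξ) = Real.cos (t * ξ - s * ξ) := by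
    rw [← sub_mul]
    rcases abs_choice (t - s) with e | e <;> rw [e]
    rw [neg_mul, Real.cos_neg]
  rw [h, ← Complex.normSq_eq_norm_sq, Complex.normSq_add_mul_I, hc, Real.cos_sub]
  nlinarith [Real.sin_sq_add_cos_sq (t * ξ), Real.sin_sq_add_cos_sq (s * ξ)]

lemma heatMultiplier_nonneg (l ξ : ℝ) : 0 ≤ ξ ^ 2 / (l ^ 2 + ξ ^ 2) := by positivity

lemma heatMultiplier_le_one (l ξ : ℝ) : ξ ^ 2 / (l ^ 2 + ξ ^ 2) ≤ 1 :=
  div_le_one_of_le₀ (by nlinarith [sq_nonneg l]) (by positivity)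

lemma sq_norm_add_le {E : Type*} [SeminormedAddCommGroup E] (a b : E) :
    ‖a + b‖ ^ 2 ≤ 2 * ‖a‖ ^ 2 + 2 * ‖b‖ ^ 2 := by
  nlinarith [norm_add_le a b, norm_nonneg (a + b), sq_nonneg (‖a‖ - ‖b‖),
    pow_le_pow_left₀ (norm_nonneg (a + b)) (norm_add_le a b) 2]

/-- An increment of the symbol is the increment of the symbol of the fractional Brownian motion,
damped by the heat multiplier, up to the contribution of the change of initial weight. -/
lemma normSq_heatSymbol_sub_le (l s t ξ : ℝ) :
    ‖heatSymbol l t ξ - heatSymbol l s ξ‖ ^ 2 ≤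
      4 * ((1 - Real.cos (|t - s| * ξ)) * (ξ ^ 2 / (l ^ 2 + ξ ^ 2))) +
        2 * (Real.exp (-l * t) - Real.exp (-l * s)) ^ 2 * (ξ ^ 2 / (l ^ 2 + ξ ^ 2)) := by
  have h := sq_norm_add_le (Complex.exp (t * ξ * Complex.I) - Complex.exp (s * ξ * Complex.I))
    (-((Real.exp (-l * t) - Real.exp (-l * s) : ℝ) : ℂ))
  rw [← sub_eq_add_neg, normSq_exp_sub_exp, norm_neg, Complex.norm_real, Real.norm_eq_abs,
    sq_abs] at h
  rw [normSq_heatSymbol_sub]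
  nlinarith [mul_le_mul_of_nonneg_right h (heatMultiplier_nonneg l ξ)]

lemma le_normSq_heatSymbol_sub (l s t ξ : ℝ) :
    (1 - Real.cos (|t - s| * ξ)) * (ξ ^ 2 / (l ^ 2 + ξ ^ 2)) ≤
      ‖heatSymbol l t ξ - heatSymbol l s ξ‖ ^ 2 +
        (Real.exp (-l * t) - Real.exp (-l * s)) ^ 2 * (ξ ^ 2 / (l ^ 2 + ξ ^ 2)) := by
  have h := sq_norm_add_le (Complex.exp (t * ξ * Complex.I) - Complex.exp (s * ξ * Complex.I) -
    ((Real.exp (-l * t) - Real.exp (-l * s) : ℝ) : ℂ))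
    (((Real.exp (-l * t) - Real.exp (-l * s) : ℝ) : ℂ))
  rw [sub_add_cancel, normSq_exp_sub_exp, Complex.norm_real, Real.norm_eq_abs, sq_abs] at h
  rw [normSq_heatSymbol_sub]
  nlinarith [mul_le_mul_of_nonneg_right h (heatMultiplier_nonneg l ξ)]

lemma measurable_heatSymbol (l t : ℝ) : Measurable (heatSymbol l t) := by
  unfold heatSymbol; fun_prop

/-- The order of magnitude `min (l^{-2H}, h^{2H})` of the variance of an increment over a time `h`
of the mode with eigenvalue `l`. -/
noncomputable def modeScale (H l h : ℝ) : ℝ := min (l ^ (-(2 * H))) (h ^ (2 * H))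

lemma modeScale_nonneg {H l h : ℝ} (hl : 0 ≤ l) (hh : 0 ≤ h) : 0 ≤ modeScale H l h :=
  le_min (Real.rpow_nonneg hl _) (Real.rpow_nonneg hh _)

section
variable {H : ℝ} (hH : H ∈ Set.Ioo (0 : ℝ) 1)
include hH

lemma integrable_one_sub_cos_mul_heatMultiplier (l h : ℝ) :
    Integrable (fun ξ => (1 - Real.cos (h * ξ)) * (ξ ^ 2 / (l ^ 2 + ξ ^ 2)))
      (spectralMeasure H) := by
  refine (integrable_one_sub_cos hH h).mono' (by fun_prop) (Eventually.of_forall fun ξ => ?_)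
  have h0 : 0 ≤ 1 - Real.cos (h * ξ) := by linarith [Real.cos_le_one (h * ξ)]
  rw [Real.norm_of_nonneg (mul_nonneg h0 (heatMultiplier_nonneg l ξ))]
  exact mul_le_of_le_one_right h0 (heatMultiplier_le_one l ξ)

lemma integral_one_sub_cos_mul_heatMultiplier_le (l h : ℝ) :
    ∫ ξ, (1 - Real.cos (h * ξ)) * (ξ ^ 2 / (l ^ 2 + ξ ^ 2)) ∂spectralMeasure H ≤
      |h| ^ (2 * H) / 2 := by
  rw [← integral_one_sub_cos hH]
  refine integral_mono (integrable_one_sub_cos_mul_heatMultiplier hH l h)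
    (integrable_one_sub_cos hH h) fun ξ => ?_
  exact mul_le_of_le_one_right (by linarith [Real.cos_le_one (h * ξ)]) (heatMultiplier_le_one l ξ)

lemma integral_one_sub_cos_mul_heatMultiplier_le' {l : ℝ} (hl : 0 < l) (h : ℝ) :
    ∫ ξ, (1 - Real.cos (h * ξ)) * (ξ ^ 2 / (l ^ 2 + ξ ^ 2)) ∂spectralMeasure H ≤
      2 * (l ^ (-(2 * H)) * ∫ ξ, ξ ^ 2 / (1 ^ 2 + ξ ^ 2) ∂spectralMeasure H) := by
  rw [← integral_heatMultiplier hH hl, ← integral_const_mul]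
  refine integral_mono (integrable_one_sub_cos_mul_heatMultiplier hH l h)
    ((integrable_heatMultiplier hH hl).const_mul 2) fun ξ => ?_
  exact mul_le_mul_of_nonneg_right (by linarith [Real.neg_one_le_cos (h * ξ)])
    (heatMultiplier_nonneg l ξ)

/-- The zero mode is the fractional Brownian motion itself. -/
lemma incrementVar_zero_le (s t : ℝ) : incrementVar H 0 s t ≤ 2 * |t - s| ^ (2 * H) := by
  have h : ∀ ξ, ‖heatSymbol 0 t ξ - heatSymbol 0 s ξ‖ ^ 2 ≤
      4 * ((1 - Real.cos (|t - s| * ξ)) * (ξ ^ 2 / (0 ^ 2 + ξ ^ 2))) := fun ξ => by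
    simpa using normSq_heatSymbol_sub_le 0 s t ξ
  calc incrementVar H 0 s t
      ≤ ∫ ξ, 4 * ((1 - Real.cos (|t - s| * ξ)) * (ξ ^ 2 / (0 ^ 2 + ξ ^ 2))) ∂spectralMeasure H :=
        integral_mono_of_nonneg (Eventually.of_forall fun _ => by positivity)
          ((integrable_one_sub_cos_mul_heatMultiplier hH 0 _).const_mul 4)
          (Eventually.of_forall h)
    _ ≤ 2 * |t - s| ^ (2 * H) := by
        rw [integral_const_mul]
        have := integral_one_sub_cos_mul_heatMultiplier_le hH 0 |t - s|
        rw [abs_abs] at this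
        linarith

omit hH in
lemma abs_exp_sub_exp_le {l t₀ s t : ℝ} (hl : 0 ≤ l) (hs : t₀ ≤ s) (ht : t₀ ≤ t) :
    |Real.exp (-l * t) - Real.exp (-l * s)| ≤ Real.exp (-l * t₀) * min 1 (l * |t - s|) := by
  wlog hst : s ≤ t generalizing s t
  · rw [abs_sub_comm, abs_sub_comm t]
    exact this ht hs (le_of_not_ge hst)
  have h1 : Real.exp (-l * t) = Real.exp (-l * s) * Real.exp (-(l * (t - s))) := by
    rw [← Real.exp_add]; congr 1; ring
  have h0 : 0 ≤ l * (t - s) := mul_nonneg hl (sub_nonneg.2 hst)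
  have h2 : Real.exp (-(l * (t - s))) ≤ 1 := Real.exp_le_one_iff.2 (by linarith)
  rw [h1, abs_sub_comm, abs_of_nonneg (sub_nonneg.2 hst), abs_of_nonneg (by
    nlinarith [Real.exp_pos (-l * s)])]
  calc Real.exp (-l * s) - Real.exp (-l * s) * Real.exp (-(l * (t - s)))
      = Real.exp (-l * s) * (1 - Real.exp (-(l * (t - s)))) := by ring
    _ ≤ Real.exp (-l * t₀) * min 1 (l * (t - s)) := by
        refine mul_le_mul (Real.exp_le_exp.2 (by nlinarith)) (le_min ?_ ?_) (by linarith)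
          (Real.exp_pos _).le
        · linarith [Real.exp_pos (-(l * (t - s)))]
        · linarith [Real.add_one_le_exp (-(l * (t - s)))]

lemma sq_exp_sub_exp_mul_le {l t₀ s t : ℝ} (hl : 0 < l) (hs : t₀ ≤ s) (ht : t₀ ≤ t) :
    (Real.exp (-l * t) - Real.exp (-l * s)) ^ 2 * l ^ (-(2 * H)) ≤
      Real.exp (-(2 * l * t₀)) * modeScale H l |t - s| := by
  have hx : 0 ≤ l * |t - s| := by positivity
  have hmin : (min 1 (l * |t - s|)) ^ 2 ≤ min 1 ((l * |t - s|) ^ (2 * H)) := by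
    rcases le_total 1 (l * |t - s|) with h | h
    · rw [min_eq_left h, min_eq_left (Real.one_le_rpow h (by linarith [hH.1]))]; norm_num
    · rw [min_eq_right h, min_eq_right (Real.rpow_le_one hx h (by linarith [hH.1])),
        ← Real.rpow_natCast]
      rcases hx.eq_or_lt with h0 | h0
      · rw [← h0, Real.zero_rpow (by norm_num), Real.zero_rpow (by linarith [hH.1])]
      · exact Real.rpow_le_rpow_of_exponent_ge h0 h (by push_cast; linarith [hH.2])
  have hscale : min 1 ((l * |t - s|) ^ (2 * H)) * l ^ (-(2 * H)) = modeScale H l |t - s| := by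
    rw [modeScale, min_mul_of_nonneg _ _ (Real.rpow_nonneg hl.le _), one_mul,
      Real.mul_rpow hl.le (abs_nonneg _), mul_right_comm, ← Real.rpow_add hl]
    simp
  have hsq : (Real.exp (-l * t) - Real.exp (-l * s)) ^ 2 ≤
      Real.exp (-(2 * l * t₀)) * (min 1 (l * |t - s|)) ^ 2 := by
    rw [← sq_abs]
    refine (pow_le_pow_left₀ (abs_nonneg _) (abs_exp_sub_exp_le hl.le hs ht) 2).trans_eq ?_
    rw [mul_pow, ← Real.exp_nat_mul]
    congr 2; push_cast; ring
  calc _ ≤ Real.exp (-(2 * l * t₀)) * min 1 ((l * |t - s|) ^ (2 * H)) * l ^ (-(2 * H)) :=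
        mul_le_mul_of_nonneg_right (hsq.trans (mul_le_mul_of_nonneg_left hmin
          (Real.exp_pos _).le)) (Real.rpow_nonneg hl.le _)
    _ = _ := by rw [mul_assoc, hscale]

lemma integrable_normSq_heatSymbol_sub {l : ℝ} (hl : 0 < l) (s t : ℝ) :
    Integrable (fun ξ => ‖heatSymbol l t ξ - heatSymbol l s ξ‖ ^ 2) (spectralMeasure H) := by
  have hm := ((measurable_heatSymbol l t).sub (measurable_heatSymbol l s)).norm.pow_const 2
  refine (((integrable_one_sub_cos_mul_heatMultiplier hH l |t - s|).const_mul 4).add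
    ((integrable_heatMultiplier hH hl).const_mul
      (2 * (Real.exp (-l * t) - Real.exp (-l * s)) ^ 2))).mono' hm.aestronglyMeasurable
    (Eventually.of_forall fun ξ => ?_)
  rw [Real.norm_of_nonneg (by positivity)]
  exact normSq_heatSymbol_sub_le l s t ξ

lemma exists_incrementVar_le :
    ∃ C > 0, ∀ l > 0, ∀ s ≥ 0, ∀ t ≥ 0, incrementVar H l s t ≤ C * modeScale H l |t - s| := by
  set J := ∫ ξ, ξ ^ 2 / (1 ^ 2 + ξ ^ 2) ∂spectralMeasure H with hJ
  have hJ0 : 0 ≤ J := integral_nonneg fun ξ => heatMultiplier_nonneg 1 ξ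
  refine ⟨2 + 10 * J, by positivity, fun l hl s hs t ht => ?_⟩
  have hA := integrable_one_sub_cos_mul_heatMultiplier hH l |t - s|
  have hM := integrable_heatMultiplier hH hl
  have h1 := integral_one_sub_cos_mul_heatMultiplier_le hH l |t - s|
  have h2 := integral_one_sub_cos_mul_heatMultiplier_le' hH hl |t - s|
  have h3 := sq_exp_sub_exp_mul_le hH hl hs ht
  rw [abs_abs] at h1
  rw [← hJ] at h2
  simp only [mul_zero, neg_zero, Real.exp_zero, one_mul] at h3
  have h0 : 0 ≤ modeScale H l |t - s| := modeScale_nonneg hl.le (abs_nonneg _)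
  have h4 : incrementVar H l s t ≤
      4 * (∫ ξ, (1 - Real.cos (|t - s| * ξ)) * (ξ ^ 2 / (l ^ 2 + ξ ^ 2)) ∂spectralMeasure H) +
      2 * (Real.exp (-l * t) - Real.exp (-l * s)) ^ 2 * (l ^ (-(2 * H)) * J) := by
    rw [← integral_heatMultiplier hH hl, ← integral_const_mul, ← integral_const_mul,
      ← integral_add (hA.const_mul _) (hM.const_mul _)]
    exact integral_mono (integrable_normSq_heatSymbol_sub hH hl s t)
      ((hA.const_mul _).add (hM.const_mul _)) fun ξ => normSq_heatSymbol_sub_le l s t ξ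
  have h5 : 4 * (∫ ξ, (1 - Real.cos (|t - s| * ξ)) * (ξ ^ 2 / (l ^ 2 + ξ ^ 2))
      ∂spectralMeasure H) ≤ (2 + 8 * J) * modeScale H l |t - s| := by
    have hl0 : 0 ≤ l ^ (-(2 * H)) := Real.rpow_nonneg hl.le _
    have hh0 : 0 ≤ |t - s| ^ (2 * H) := Real.rpow_nonneg (abs_nonneg _) _
    unfold modeScale
    rcases min_cases (l ^ (-(2 * H))) (|t - s| ^ (2 * H)) with h | h <;> rw [h.1] <;>
    nlinarith [mul_nonneg hJ0 hl0, mul_nonneg hJ0 hh0]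
  nlinarith [mul_le_mul_of_nonneg_right h3 hJ0]

omit hH in
lemma modeScale_eq_rpow {l h : ℝ} (hH0 : 0 ≤ H) (hl : 0 < l) (hh : 0 < h) :
    modeScale H l h = (max l h⁻¹) ^ (-(2 * H)) := by
  have hinv : h ^ (2 * H) = h⁻¹ ^ (-(2 * H)) := by
    rw [Real.inv_rpow hh.le, Real.rpow_neg hh.le, inv_inv]
  rw [modeScale, hinv]
  rcases le_total l h⁻¹ with hc | hc
  · rw [max_eq_right hc, min_eq_right (Real.rpow_le_rpow_of_nonpos hl hc (by linarith))]
  · rw [max_eq_left hc,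
      min_eq_left (Real.rpow_le_rpow_of_nonpos (inv_pos.2 hh) hc (by linarith))]

/-- Away from time zero the contribution of the initial weight is exponentially small in `l`, so
that the upper bound of `exists_incrementVar_le` is sharp for the high modes. -/
lemma exists_le_incrementVar {t₀ : ℝ} (ht₀ : 0 < t₀) :
    ∃ c > 0, ∃ L > 0, ∀ l ≥ L, ∀ s ≥ t₀, ∀ t ≥ t₀,
      c * modeScale H l |t - s| ≤ incrementVar H l s t := by
  set J := ∫ ξ, ξ ^ 2 / (1 ^ 2 + ξ ^ 2) ∂spectralMeasure H with hJ
  have hJ0 : 0 ≤ J := integral_nonneg fun ξ => heatMultiplier_nonneg 1 ξ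
  set c := (4 : ℝ) ^ (-1 - 2 * H) / (4 * spectralConst H) with hc
  have hc0 : 0 < c := by have := spectralConst_pos hH; positivity
  have hlim : Tendsto (fun l : ℝ => Real.exp (-(2 * l * t₀)) * J) atTop (𝓝 (0 * J)) := by
    refine Tendsto.mul_const _ (Real.tendsto_exp_neg_atTop_nhds_zero.comp ?_)
    simp_rw [mul_right_comm _ _ t₀]
    exact tendsto_id.const_mul_atTop (by positivity)
  rw [zero_mul] at hlim
  obtain ⟨L, hL⟩ := eventually_atTop.1 ((hlim.eventually (gt_mem_nhds (half_pos hc0))).and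
    (eventually_gt_atTop 0))
  refine ⟨c / 2, half_pos hc0, L, (hL L le_rfl).2, fun l hlL s hs t ht => ?_⟩
  obtain ⟨hsmall, hl⟩ := hL l hlL
  rcases eq_or_ne t s with rfl | hne
  · rw [sub_self, abs_zero, modeScale, Real.zero_rpow (by linarith [hH.1]),
      min_eq_right (Real.rpow_nonneg hl.le _), mul_zero]
    exact incrementVar_nonneg _ _ _ _
  have hh : 0 < |t - s| := abs_pos.2 (sub_ne_zero.2 hne)
  have hA := integrable_one_sub_cos_mul_heatMultiplier hH l |t - s|
  have hM := integrable_heatMultiplier hH hl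
  have hV := integrable_normSq_heatSymbol_sub hH hl s t
  have h1 := le_integral_one_sub_cos_mul_heatMultiplier hH hh hl.le
    (m := max l |t - s|⁻¹) (lt_max_of_lt_left hl) (le_max_left _ _)
    (by rw [← inv_le_iff_one_le_mul₀ hh]; exact le_max_right _ _)
  rw [← modeScale_eq_rpow hH.1.le hl hh, ← hc] at h1
  have h2 : ∫ ξ, (1 - Real.cos (|t - s| * ξ)) * (ξ ^ 2 / (l ^ 2 + ξ ^ 2)) ∂spectralMeasure H ≤
      incrementVar H l s t +
        (Real.exp (-l * t) - Real.exp (-l * s)) ^ 2 * (l ^ (-(2 * H)) * J) := by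
    rw [← integral_heatMultiplier hH hl, ← integral_const_mul, incrementVar,
      ← integral_add hV (hM.const_mul _)]
    exact integral_mono hA (hV.add (hM.const_mul _)) fun ξ => le_normSq_heatSymbol_sub l s t ξ
  have h3 := sq_exp_sub_exp_mul_le hH hl hs ht
  have h0 : 0 ≤ modeScale H l |t - s| := modeScale_nonneg hl.le hh.le
  nlinarith [mul_le_mul_of_nonneg_right h3 hJ0, mul_le_mul_of_nonneg_right hsmall.le h0]

end

/-! ### Summation over the Fourier modes -/

/-- By the mean value theorem, `(x + 1) ^ (r - 1)` is dominated by a telescoping difference; this serves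
both the partial sums (`0 < r`) and the tails (`r < 0`) of sums of powers. -/
lemma rpow_sub_one_le_telescope {r : ℝ} (hr : r ≤ 1) (hr0 : r ≠ 0) {x : ℝ} (hx : 0 < x) :
    (x + 1) ^ (r - 1) ≤ (x + 1) ^ r / r - x ^ r / r := by
  obtain ⟨y, hy, hy'⟩ := exists_hasDerivAt_eq_slope (fun z : ℝ => z ^ r / r)
    (fun z => r * z ^ (r - 1) / r) (lt_add_one x)
    (fun z hz => ((Real.continuousAt_rpow_const z r
      (Or.inl (hx.trans_le hz.1).ne')).div_const r).continuousWithinAt)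
    (fun z hz => (Real.hasDerivAt_rpow_const (Or.inl (hx.trans hz.1).ne')).div_const r)
  rw [mul_div_cancel_left₀ _ hr0, add_sub_cancel_left, div_one] at hy'
  rw [← hy']
  exact Real.rpow_le_rpow_of_nonpos (hx.trans hy.1) hy.2.le (by linarith)

lemma sum_rpow_sub_one_le {p : ℝ} (hp : 0 < p) (hp1 : p ≤ 1) {M : ℕ} (hM : 1 ≤ M) :
    ∑ n ∈ Finset.Ico 1 (M + 1), (n : ℝ) ^ (p - 1) ≤ (M : ℝ) ^ p / p := by
  induction M, hM using Nat.le_induction with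
  | base => simpa using (one_le_inv₀ hp).2 hp1
  | succ M hM ih =>
    rw [Finset.sum_Ico_succ_top (by omega)]
    have := rpow_sub_one_le_telescope hp1 hp.ne' (x := M) (by exact_mod_cast hM)
    push_cast
    linarith

lemma sum_rpow_tail_le {q : ℝ} (hq : 0 < q) {M : ℕ} (hM : 1 ≤ M) (N : ℕ) :
    ∑ n ∈ Finset.Ico M N, ((n : ℝ) + 1) ^ (-q - 1) ≤ (M : ℝ) ^ (-q) / q := by
  rcases le_total N M with h | h
  · rw [Finset.Ico_eq_empty_of_le h, Finset.sum_empty]; positivity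
  have key : ∑ n ∈ Finset.Ico M N, ((n : ℝ) + 1) ^ (-q - 1) ≤
      (M : ℝ) ^ (-q) / q - (N : ℝ) ^ (-q) / q := by
    induction N, h using Nat.le_induction with
    | base => simp
    | succ N hN ih =>
      rw [Finset.sum_Ico_succ_top hN]
      have := rpow_sub_one_le_telescope (r := -q) (by linarith) (by linarith) (x := N)
        (by exact_mod_cast hM.trans hN)
      rw [div_neg, div_neg] at this
      push_cast
      linarith
  have : 0 ≤ (N : ℝ) ^ (-q) / q := by positivity
  linarith

lemma rpow_sq_neg_two_mul (H : ℝ) (n : ℕ) : ((n : ℝ) ^ 2) ^ (-(2 * H)) = (n : ℝ) ^ (-(4 * H)) := by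
  rw [← Real.rpow_natCast, ← Real.rpow_mul (Nat.cast_nonneg n)]
  congr 1; push_cast; ring

/-- The terms `n^{4H-2α-1} min (n^{-4H}, h^{2H})` change behaviour at `n ≈ h^{-1/2}`. Below this
index the sum has order `h^{2H} h^{α-2H}` when `α < 2H` and `h^{2H}` when `α > 2H`; above it, its
order is `h^α`. -/
lemma exists_sum_modeScale_le {H α : ℝ} (hα : 0 < α) (hαH : α ≠ 2 * H) :
    ∃ C > 0, ∀ h > 0, h ≤ 1 → ∀ N : ℕ,
      ∑ n ∈ Finset.Ico 1 N, (n : ℝ) ^ (4 * H - 2 * α - 1) * modeScale H ((n : ℝ) ^ 2) h ≤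
        C * h ^ min α (2 * H) := by
  rcases lt_or_gt_of_ne hαH with hlt | hgt
  · set p := 4 * H - 2 * α with hp
    have hp0 : 0 < p := by linarith
    set p' := min p 1 with hp'
    have hp'0 : 0 < p' := lt_min hp0 one_pos
    refine ⟨1 / p' + 2 ^ (2 * α + 1) / (2 * α), by positivity, fun h hh hh1 N => ?_⟩
    rw [min_eq_left hlt.le]
    set R := h ^ (-(1 / 2) : ℝ) with hR
    have hR1 : 1 ≤ R := Real.one_le_rpow_of_pos_of_le_one_of_nonpos hh hh1 (by norm_num)
    have hR0 : 0 < R := one_pos.trans_le hR1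
    set M := ⌊R⌋₊ with hM
    have hM1 : 1 ≤ M := Nat.le_floor (by simpa using hR1)
    have hMR : (M : ℝ) ≤ R := Nat.floor_le hR0.le
    have hMR' : R < (M : ℝ) + 1 := Nat.lt_floor_add_one R
    have hh2 : 0 ≤ h ^ (2 * H) := Real.rpow_nonneg hh.le _
    have hnn : ∀ n : ℕ, 0 ≤ (n : ℝ) ^ (p - 1) * modeScale H ((n : ℝ) ^ 2) h := fun n =>
      mul_nonneg (Real.rpow_nonneg (Nat.cast_nonneg n) _) (modeScale_nonneg (by positivity) hh.le)
    have hlow : ∑ n ∈ Finset.Ico 1 (M + 1), (n : ℝ) ^ (p - 1) * modeScale H ((n : ℝ) ^ 2) h ≤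
        1 / p' * h ^ α := by
      have hterm : ∀ n ∈ Finset.Ico 1 (M + 1),
          (n : ℝ) ^ (p - 1) * modeScale H ((n : ℝ) ^ 2) h ≤
            (n : ℝ) ^ (p' - 1) * (R ^ (p - p') * h ^ (2 * H)) := fun n hn => by
        rw [Finset.mem_Ico] at hn
        have hn0 : (0 : ℝ) < n := by exact_mod_cast hn.1
        have hnR : (n : ℝ) ≤ R := le_trans (by exact_mod_cast Nat.lt_succ_iff.1 hn.2) hMR
        rw [show p - 1 = (p' - 1) + (p - p') by ring, Real.rpow_add hn0, mul_assoc]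
        refine mul_le_mul_of_nonneg_left ?_ (Real.rpow_nonneg hn0.le _)
        exact mul_le_mul (Real.rpow_le_rpow hn0.le hnR (sub_nonneg.2 (min_le_left _ _)))
          (min_le_right _ _) (modeScale_nonneg (by positivity) hh.le) (by positivity)
      refine (Finset.sum_le_sum hterm).trans ?_
      rw [← Finset.sum_mul]
      calc _ ≤ (M : ℝ) ^ p' / p' * (R ^ (p - p') * h ^ (2 * H)) :=
            mul_le_mul_of_nonneg_right (sum_rpow_sub_one_le hp'0 (min_le_right _ _) hM1)
              (by positivity)
        _ ≤ R ^ p' / p' * (R ^ (p - p') * h ^ (2 * H)) := by gcongr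
        _ = 1 / p' * ((R ^ p' * R ^ (p - p')) * h ^ (2 * H)) := by ring
        _ = 1 / p' * h ^ α := by
            rw [← Real.rpow_add hR0, hR, ← Real.rpow_mul hh.le, ← Real.rpow_add hh]
            congr 2; rw [hp]; ring
    have hhigh : ∑ n ∈ Finset.Ico (M + 1) N,
        (n : ℝ) ^ (p - 1) * modeScale H ((n : ℝ) ^ 2) h ≤ 2 ^ (2 * α + 1) / (2 * α) * h ^ α := by
      have hterm : ∀ n ∈ Finset.Ico (M + 1) N,
          (n : ℝ) ^ (p - 1) * modeScale H ((n : ℝ) ^ 2) h ≤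
            2 ^ (2 * α + 1) * ((n : ℝ) + 1) ^ (-(2 * α) - 1) := fun n hn => by
        rw [Finset.mem_Ico] at hn
        have hn0 : (1 : ℝ) ≤ n := by exact_mod_cast (show 1 ≤ n by omega)
        calc _ ≤ (n : ℝ) ^ (p - 1) * ((n : ℝ) ^ 2) ^ (-(2 * H)) :=
              mul_le_mul_of_nonneg_left (min_le_left _ _) (by positivity)
          _ = 2 ^ (2 * α + 1) * (2 * (n : ℝ)) ^ (-(2 * α) - 1) := by
              rw [rpow_sq_neg_two_mul, ← Real.rpow_add (by linarith),
                Real.mul_rpow (by norm_num) (by linarith), ← mul_assoc,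
                ← Real.rpow_add (by norm_num)]
              rw [show 2 * α + 1 + (-(2 * α) - 1) = 0 by ring, Real.rpow_zero, one_mul]
              congr 1; rw [hp]; ring
          _ ≤ _ := mul_le_mul_of_nonneg_left (Real.rpow_le_rpow_of_nonpos (by linarith)
              (by linarith) (by linarith)) (by positivity)
      refine (Finset.sum_le_sum hterm).trans ?_
      rw [← Finset.mul_sum]
      calc _ ≤ (2 : ℝ) ^ (2 * α + 1) * (((M + 1 : ℕ) : ℝ) ^ (-(2 * α)) / (2 * α)) :=
            mul_le_mul_of_nonneg_left (sum_rpow_tail_le (by linarith) (by omega) N)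
              (by positivity)
        _ ≤ (2 : ℝ) ^ (2 * α + 1) * (R ^ (-(2 * α)) / (2 * α)) := by
            push_cast
            have := Real.rpow_le_rpow_of_nonpos hR0 hMR'.le (z := -(2 * α)) (by linarith)
            gcongr
        _ = _ := by
            rw [hR, ← Real.rpow_mul hh.le, show -(1 / 2) * -(2 * α) = α by ring]
            ring
    calc _ ≤ ∑ n ∈ Finset.Ico 1 (M + 1) ∪ Finset.Ico (M + 1) N,
          (n : ℝ) ^ (p - 1) * modeScale H ((n : ℝ) ^ 2) h := by
          refine Finset.sum_le_sum_of_subset_of_nonneg (fun n hn => ?_) fun n _ _ => hnn n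
          simp only [Finset.mem_union, Finset.mem_Ico] at hn ⊢
          omega
      _ = _ := Finset.sum_union (Finset.Ico_disjoint_Ico_consecutive 1 (M + 1) N)
      _ ≤ _ := by rw [add_mul]; exact add_le_add hlow hhigh
  · have hsum : Summable fun n : ℕ => (n : ℝ) ^ (4 * H - 2 * α - 1) :=
      Real.summable_nat_rpow.2 (by linarith)
    have hnn : ∀ n : ℕ, 0 ≤ (n : ℝ) ^ (4 * H - 2 * α - 1) := fun n =>
      Real.rpow_nonneg (Nat.cast_nonneg n) _
    refine ⟨∑' n : ℕ, (n : ℝ) ^ (4 * H - 2 * α - 1) + 1,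
      add_pos_of_nonneg_of_pos (tsum_nonneg hnn) one_pos, fun h hh _ N => ?_⟩
    rw [min_eq_right (le_of_lt hgt)]
    have hh2 : 0 ≤ h ^ (2 * H) := Real.rpow_nonneg hh.le _
    calc _ ≤ ∑ n ∈ Finset.Ico 1 N, (n : ℝ) ^ (4 * H - 2 * α - 1) * h ^ (2 * H) :=
          Finset.sum_le_sum fun n _ => mul_le_mul_of_nonneg_left (min_le_right _ _) (hnn n)
      _ ≤ _ := by
          rw [← Finset.sum_mul]
          refine mul_le_mul_of_nonneg_right ?_ hh2
          linarith [hsum.sum_le_tsum (Finset.Ico 1 N) fun n _ => hnn n]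

/-- For `α < 2H` the lower bound comes from about `h^{-1/2}` modes with index of order `h^{-1/2}`,
for `α > 2H` from a single mode. -/
lemma exists_le_sum_modeScale {H α : ℝ} (hH : H ∈ Set.Ioo (0 : ℝ) 1)
    (hα : 0 < α) {n₁ : ℕ} (hn₁ : 1 ≤ n₁) :
    ∃ c > 0, ∀ h > 0, h ≤ 1 → ∃ N : ℕ, c * h ^ min α (2 * H) ≤
      ∑ n ∈ Finset.Ico n₁ N, (n : ℝ) ^ (4 * H - 2 * α - 1) * modeScale H ((n : ℝ) ^ 2) h := by
  have hn₁0 : (1 : ℝ) ≤ n₁ := by exact_mod_cast hn₁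
  rcases le_or_gt α (2 * H) with hle | hgt
  · refine ⟨2 ^ (-(2 * α) - 1) * (2 * n₁) ^ (-(2 * α)), by positivity, fun h hh hh1 => ?_⟩
    rw [min_eq_left hle]
    set R := h ^ (-(1 / 2) : ℝ) with hR
    have hR1 : 1 ≤ R := Real.one_le_rpow_of_pos_of_le_one_of_nonpos hh hh1 (by norm_num)
    have hnR : 1 ≤ n₁ * R := one_le_mul_of_one_le_of_one_le hn₁0 hR1
    set N := ⌈n₁ * R⌉₊ with hN
    have hNR : n₁ * R ≤ N := Nat.le_ceil _
    have hNR' : (N : ℝ) ≤ 2 * n₁ * R := by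
      have := Nat.ceil_lt_add_one (show 0 ≤ n₁ * R by linarith)
      linarith
    have hN1 : (1 : ℝ) ≤ N := hnR.trans hNR
    have hnN : n₁ ≤ N := by
      have : (n₁ : ℝ) ≤ N := (le_mul_of_one_le_right (by linarith) hR1).trans hNR
      exact_mod_cast this
    refine ⟨2 * N, ?_⟩
    have hterm : ∀ n ∈ Finset.Ico N (2 * N), (2 * (N : ℝ)) ^ (-(2 * α) - 1) ≤
        (n : ℝ) ^ (4 * H - 2 * α - 1) * modeScale H ((n : ℝ) ^ 2) h := fun n hn => by
      rw [Finset.mem_Ico] at hn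
      have hNn : (N : ℝ) ≤ n := by exact_mod_cast hn.1
      have hn2 : (n : ℝ) ≤ 2 * N := by exact_mod_cast hn.2.le
      have hn0 : (0 : ℝ) < n := by linarith
      have hRn : R ≤ n := by nlinarith
      have hms : modeScale H ((n : ℝ) ^ 2) h = (n : ℝ) ^ (-(4 * H)) := by
        rw [modeScale, rpow_sq_neg_two_mul, min_eq_left]
        calc (n : ℝ) ^ (-(4 * H)) ≤ R ^ (-(4 * H)) :=
              Real.rpow_le_rpow_of_nonpos (by linarith) hRn (by linarith [hH.1])
          _ = _ := by rw [hR, ← Real.rpow_mul hh.le]; congr 1; ring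
      rw [hms, ← Real.rpow_add hn0, show 4 * H - 2 * α - 1 + -(4 * H) = -(2 * α) - 1 by ring]
      exact Real.rpow_le_rpow_of_nonpos hn0 hn2 (by linarith)
    calc 2 ^ (-(2 * α) - 1) * (2 * (n₁ : ℝ)) ^ (-(2 * α)) * h ^ α
        = 2 ^ (-(2 * α) - 1) * (2 * n₁ * R) ^ (-(2 * α)) := by
          rw [Real.mul_rpow (x := 2 * (n₁ : ℝ)) (by linarith) (by linarith), hR,
            ← Real.rpow_mul hh.le, show -(1 / 2) * -(2 * α) = α by ring, mul_assoc]
      _ ≤ 2 ^ (-(2 * α) - 1) * (N : ℝ) ^ (-(2 * α)) :=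
          mul_le_mul_of_nonneg_left (Real.rpow_le_rpow_of_nonpos (by linarith) hNR'
            (by linarith)) (by positivity)
      _ = ∑ n ∈ Finset.Ico N (2 * N), (2 * (N : ℝ)) ^ (-(2 * α) - 1) := by
          rw [Finset.sum_const, Nat.card_Ico, show 2 * N - N = N by omega, nsmul_eq_mul,
            Real.mul_rpow (by norm_num) (by linarith), mul_left_comm]
          congr 1
          rw [show -(2 * α) = (-(2 * α) - 1) + 1 by ring, Real.rpow_add (by linarith),
            Real.rpow_one]
          ring_nf
      _ ≤ _ := (Finset.sum_le_sum hterm).trans (Finset.sum_le_sum_of_subset_of_nonneg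
          (Finset.Ico_subset_Ico_left hnN) fun n _ _ => mul_nonneg (by positivity)
            (modeScale_nonneg (by positivity) hh.le))
  · refine ⟨(n₁ : ℝ) ^ (4 * H - 2 * α - 1) * (n₁ : ℝ) ^ (-(4 * H)), by positivity,
      fun h hh hh1 => ⟨n₁ + 1, ?_⟩⟩
    have hh2 : h ^ (2 * H) ≤ 1 := Real.rpow_le_one hh.le hh1 (by linarith [hH.1])
    have hn2 : (n₁ : ℝ) ^ (-(4 * H)) ≤ 1 :=
      Real.rpow_le_one_of_one_le_of_nonpos hn₁0 (by linarith [hH.1])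
    have h0 : 0 ≤ h ^ (2 * H) := Real.rpow_nonneg hh.le _
    have h1 : 0 ≤ (n₁ : ℝ) ^ (-(4 * H)) := by positivity
    rw [min_eq_right hgt.le, Nat.Ico_succ_singleton, Finset.sum_singleton, mul_assoc, modeScale,
      rpow_sq_neg_two_mul]
    exact mul_le_mul_of_nonneg_left (le_min (mul_le_of_le_one_right h1 hh2)
      (mul_le_of_le_one_left h0 hn2)) (by positivity)

/-- The modes below `n₀` contribute `O(h^{2H})`, where the mode `n = 0` needs a separate bound because
its eigenvalue vanishes. -/
lemma exists_sum_incrementVar_le {H α : ℝ} (hH : H ∈ Set.Ioo (0 : ℝ) 1)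
    (hα : 0 < α) (hαH : α ≠ 2 * H) {A : ℝ} (hA : 0 < A) (M : ℝ) {n₀ : ℕ} (hn₀ : 1 ≤ n₀) :
    ∃ C > 0, ∀ q : ℕ → ℝ, (∀ n, 0 ≤ q n) → (∀ n < n₀, q n ≤ M) →
      (∀ n ≥ n₀, q n ≤ A * (n : ℝ) ^ (4 * H - 2 * α - 1)) →
      ∀ s ≥ 0, ∀ t ≥ 0, 0 < |t - s| → |t - s| ≤ 1 → ∀ N : ℕ,
        ∑ n ∈ Finset.range N, q n * incrementVar H ((n : ℝ) ^ 2) s t ≤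
          C * |t - s| ^ min α (2 * H) := by
  obtain ⟨C₁, hC₁, hV⟩ := exists_incrementVar_le hH
  obtain ⟨C₂, hC₂, hS⟩ := exists_sum_modeScale_le hα hαH
  refine ⟨n₀ * (|M| * (2 + C₁)) + A * C₁ * C₂, by positivity,
    fun q hq hqM hqA s hs t ht hh hh1 N => ?_⟩
  have hVle : ∀ n : ℕ, 1 ≤ n → incrementVar H ((n : ℝ) ^ 2) s t ≤
      C₁ * modeScale H ((n : ℝ) ^ 2) |t - s| := fun n hn => by
    have : (0 : ℝ) < n := by exact_mod_cast hn
    exact hV _ (by positivity) s hs t ht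
  have hterm0 : ∀ n : ℕ, 0 ≤ q n * incrementVar H ((n : ℝ) ^ 2) s t := fun n =>
    mul_nonneg (hq n) (incrementVar_nonneg _ _ _ _)
  have hpow : |t - s| ^ (2 * H) ≤ |t - s| ^ min α (2 * H) :=
    Real.rpow_le_rpow_of_exponent_ge hh hh1 (min_le_right _ _)
  have h2H : 0 ≤ |t - s| ^ (2 * H) := Real.rpow_nonneg (abs_nonneg _) _
  have hlow : ∑ n ∈ Finset.range n₀, q n * incrementVar H ((n : ℝ) ^ 2) s t ≤
      n₀ * (|M| * (2 + C₁)) * |t - s| ^ min α (2 * H) := by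
    have : ∀ n ∈ Finset.range n₀, q n * incrementVar H ((n : ℝ) ^ 2) s t ≤
        |M| * ((2 + C₁) * |t - s| ^ min α (2 * H)) := fun n hn => by
      refine mul_le_mul ((hqM n (Finset.mem_range.1 hn)).trans (le_abs_self M)) ?_
        (incrementVar_nonneg _ _ _ _) (abs_nonneg _)
      refine le_trans ?_ (mul_le_mul_of_nonneg_left hpow (by positivity))
      rcases Nat.eq_zero_or_pos n with rfl | hn0
      · have := incrementVar_zero_le hH s t
        simp only [Nat.cast_zero, ne_eq, OfNat.ofNat_ne_zero, not_false_eq_true, zero_pow]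
        nlinarith
      · have h1 := hVle n hn0
        have h2 : modeScale H ((n : ℝ) ^ 2) |t - s| ≤ |t - s| ^ (2 * H) := min_le_right _ _
        nlinarith
    refine (Finset.sum_le_sum this).trans_eq ?_
    rw [Finset.sum_const, Finset.card_range, nsmul_eq_mul]; ring
  have hhigh : ∑ n ∈ Finset.Ico n₀ N, q n * incrementVar H ((n : ℝ) ^ 2) s t ≤
      A * C₁ * C₂ * |t - s| ^ min α (2 * H) := by
    calc _ ≤ ∑ n ∈ Finset.Ico n₀ N, A * C₁ *
          ((n : ℝ) ^ (4 * H - 2 * α - 1) * modeScale H ((n : ℝ) ^ 2) |t - s|) := by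
          refine Finset.sum_le_sum fun n hn => ?_
          rw [Finset.mem_Ico] at hn
          refine (mul_le_mul (hqA n hn.1) (hVle n (hn₀.trans hn.1)) (incrementVar_nonneg _ _ _ _)
            (by positivity)).trans_eq (by ring)
      _ ≤ ∑ n ∈ Finset.Ico 1 N, A * C₁ *
          ((n : ℝ) ^ (4 * H - 2 * α - 1) * modeScale H ((n : ℝ) ^ 2) |t - s|) :=
          Finset.sum_le_sum_of_subset_of_nonneg (Finset.Ico_subset_Ico_left hn₀) fun n _ _ =>
            mul_nonneg (by positivity) (mul_nonneg (by positivity)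
              (modeScale_nonneg (by positivity) hh.le))
      _ ≤ _ := by
          rw [← Finset.mul_sum, mul_assoc (A * C₁)]
          exact mul_le_mul_of_nonneg_left (hS _ hh hh1 N) (by positivity)
  calc _ ≤ ∑ n ∈ Finset.range n₀ ∪ Finset.Ico n₀ N, q n * incrementVar H ((n : ℝ) ^ 2) s t := by
        refine Finset.sum_le_sum_of_subset_of_nonneg (fun n hn => ?_) fun n _ _ => hterm0 n
        simp only [Finset.mem_union, Finset.mem_Ico, Finset.mem_range] at hn ⊢
        omega
    _ = _ := Finset.sum_union (by
        rw [Finset.range_eq_Ico]; exact Finset.Ico_disjoint_Ico_consecutive 0 n₀ N)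
    _ ≤ _ := by rw [add_mul]; exact add_le_add hlow hhigh

lemma exists_le_sum_incrementVar {H α : ℝ} (hH : H ∈ Set.Ioo (0 : ℝ) 1)
    (hα : 0 < α) {a t₀ : ℝ} (ha : 0 < a) (ht₀ : 0 < t₀) {n₀ : ℕ} (hn₀ : 1 ≤ n₀) :
    ∃ c > 0, ∀ q : ℕ → ℝ, (∀ n, 0 ≤ q n) →
      (∀ n ≥ n₀, a * (n : ℝ) ^ (4 * H - 2 * α - 1) ≤ q n) →
      ∀ s ≥ t₀, ∀ t ≥ t₀, 0 < |t - s| → |t - s| ≤ 1 → ∃ N : ℕ,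
        c * |t - s| ^ min α (2 * H) ≤
          ∑ n ∈ Finset.range N, q n * incrementVar H ((n : ℝ) ^ 2) s t := by
  obtain ⟨c₁, hc₁, L, hL, hV⟩ := exists_le_incrementVar hH ht₀
  have hn₁ : 1 ≤ max n₀ ⌈L⌉₊ := hn₀.trans (le_max_left _ _)
  obtain ⟨c₂, hc₂, hS⟩ := exists_le_sum_modeScale hH hα hn₁
  refine ⟨a * c₁ * c₂, by positivity, fun q hq hqa s hs t ht hh hh1 => ?_⟩
  obtain ⟨N, hN⟩ := hS _ hh hh1
  refine ⟨N, ?_⟩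
  calc _ = a * c₁ * (c₂ * |t - s| ^ min α (2 * H)) := by ring
    _ ≤ a * c₁ * ∑ n ∈ Finset.Ico (max n₀ ⌈L⌉₊) N,
        (n : ℝ) ^ (4 * H - 2 * α - 1) * modeScale H ((n : ℝ) ^ 2) |t - s| :=
        mul_le_mul_of_nonneg_left hN (by positivity)
    _ ≤ ∑ n ∈ Finset.Ico (max n₀ ⌈L⌉₊) N, q n * incrementVar H ((n : ℝ) ^ 2) s t := by
        rw [Finset.mul_sum]
        refine Finset.sum_le_sum fun n hn => ?_
        rw [Finset.mem_Ico] at hn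
        have hn0 : n₀ ≤ n := (le_max_left _ _).trans hn.1
        have hnL : L ≤ (n : ℝ) := (Nat.le_ceil L).trans
          (by exact_mod_cast (le_max_right n₀ _).trans hn.1)
        have hn1 : (1 : ℝ) ≤ n := by exact_mod_cast hn₀.trans hn0
        refine le_trans (le_of_eq (by ring)) (mul_le_mul (hqa n hn0)
          (hV ((n : ℝ) ^ 2) (by nlinarith) s hs t ht) (mul_nonneg hc₁.le
            (modeScale_nonneg (by positivity) hh.le)) (hq n))
    _ ≤ _ := Finset.sum_le_sum_of_subset_of_nonneg
        (by rw [Finset.range_eq_Ico]; exact Finset.Ico_subset_Ico_left (Nat.zero_le _))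
        fun n _ _ => mul_nonneg (hq n) (incrementVar_nonneg _ _ _ _)

/-! ### Dyadic chaining -/

/-- The `j`-th point of the dyadic grid of mesh `2^{-k}` that starts at `a`. -/
noncomputable def dyadicPoint (a : ℝ≥0) (k j : ℕ) : ℝ≥0 := a + j / 2 ^ k

/-- The largest point of the grid of mesh `2^{-k}` that is at most `t`, for `t ≥ a`. -/
noncomputable def dyadicProj (a : ℝ≥0) (k : ℕ) (t : ℝ≥0) : ℝ≥0 :=
  dyadicPoint a k ⌊(2 : ℝ≥0) ^ k * (t - a)⌋₊

/-- All increments of `x` between neighbours of the grid of mesh `2^{-k}` in `[a,T]` are at most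
`δ`. -/
def DyadicGap {E : Type*} [PseudoMetricSpace E] (a T : ℝ≥0) (x : ℝ≥0 → E) (k : ℕ) (δ : ℝ) : Prop :=
  ∀ j, dyadicPoint a k (j + 1) ≤ T → dist (x (dyadicPoint a k (j + 1))) (x (dyadicPoint a k j)) ≤ δ

lemma dyadicPoint_mono (a : ℝ≥0) (k : ℕ) : Monotone (dyadicPoint a k) := fun i j h => by
  unfold dyadicPoint
  gcongr

lemma dyadicPoint_succ_double (a : ℝ≥0) (k j : ℕ) :
    dyadicPoint a (k + 1) (2 * j) = dyadicPoint a k j := by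
  unfold dyadicPoint
  congr 1
  push_cast
  rw [pow_succ, mul_comm, mul_div_mul_right _ _ two_ne_zero]

lemma le_dyadicProj (a : ℝ≥0) (k : ℕ) (t : ℝ≥0) : a ≤ dyadicProj a k t := le_self_add

lemma dyadicProj_le {a t : ℝ≥0} (h : a ≤ t) (k : ℕ) : dyadicProj a k t ≤ t := by
  have h1 : (⌊(2 : ℝ≥0) ^ k * (t - a)⌋₊ : ℝ≥0) / 2 ^ k ≤ t - a := by
    rw [div_le_iff₀' (by positivity)]
    exact Nat.floor_le zero_le
  calc dyadicProj a k t ≤ a + (t - a) := by unfold dyadicProj dyadicPoint; gcongr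
    _ = t := add_tsub_cancel_of_le h

lemma dyadicProj_mem {a T t : ℝ≥0} (h : t ∈ Set.Icc a T) (k : ℕ) :
    dyadicProj a k t ∈ Set.Icc a T :=
  ⟨le_dyadicProj a k t, (dyadicProj_le h.1 k).trans h.2⟩

lemma sub_dyadicProj_le {a t : ℝ≥0} (h : a ≤ t) (k : ℕ) :
    |(t : ℝ) - dyadicProj a k t| ≤ (1 / 2) ^ k := by
  have h0 : (dyadicProj a k t : ℝ) ≤ t := dyadicProj_le h k
  rw [abs_of_nonneg (sub_nonneg.2 h0)]
  have h1 := Nat.lt_floor_add_one ((2 : ℝ≥0) ^ k * (t - a))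
  have h2 : (2 : ℝ) ^ k * (t - a) < (⌊(2 : ℝ≥0) ^ k * (t - a)⌋₊ : ℝ) + 1 := by
    have := NNReal.coe_lt_coe.2 h1
    rw [NNReal.coe_mul, NNReal.coe_sub h] at this
    exact_mod_cast this
  have h3 : (0 : ℝ) < 2 ^ k := by positivity
  have h4 : (dyadicProj a k t : ℝ) = a + (⌊(2 : ℝ≥0) ^ k * (t - a)⌋₊ : ℝ) / 2 ^ k := by
    unfold dyadicProj dyadicPoint; push_cast; rfl
  rw [h4, one_div, inv_pow, ← sub_sub, sub_le_iff_le_add, ← one_div, ← add_div, le_div_iff₀ h3]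
  nlinarith

lemma tendsto_dyadicProj {a t : ℝ≥0} (h : a ≤ t) :
    Tendsto (fun k => dyadicProj a k t) atTop (𝓝 t) := by
  rw [tendsto_iff_dist_tendsto_zero]
  refine squeeze_zero (fun _ => dist_nonneg) (fun k => ?_)
    (tendsto_pow_atTop_nhds_zero_of_lt_one (r := (1 / 2 : ℝ)) (by norm_num) (by norm_num))
  rw [dist_comm, NNReal.dist_eq]
  exact sub_dyadicProj_le h k

section Chaining
variable {E : Type*} [PseudoMetricSpace E] {a T : ℝ≥0} {x : ℝ≥0 → E}

lemma DyadicGap.dist_proj_succ_le {k : ℕ} {δ : ℝ} (hδ : 0 ≤ δ) (h : DyadicGap a T x (k + 1) δ)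
    {t : ℝ≥0} (ht : t ∈ Set.Icc a T) :
    dist (x (dyadicProj a (k + 1) t)) (x (dyadicProj a k t)) ≤ δ := by
  have hmem := dyadicProj_mem ht (k + 1)
  unfold dyadicProj at hmem ⊢
  set y := (2 : ℝ≥0) ^ k * (t - a) with hy
  rw [show (2 : ℝ≥0) ^ (k + 1) * (t - a) = 2 * y by rw [hy, pow_succ]; ring] at hmem ⊢
  rw [← dyadicPoint_succ_double a k]
  have h1 : 2 * ⌊y⌋₊ ≤ ⌊2 * y⌋₊ := Nat.le_floor (by
    push_cast; exact mul_le_mul_of_nonneg_left (Nat.floor_le zero_le) zero_le)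
  have h2 : ⌊2 * y⌋₊ < 2 * ⌊y⌋₊ + 2 := by
    rw [Nat.floor_lt zero_le]
    push_cast
    have := Nat.lt_floor_add_one y
    calc 2 * y < 2 * ((⌊y⌋₊ : ℝ≥0) + 1) := mul_lt_mul_of_pos_left this two_pos
      _ = _ := by ring
  rcases (show ⌊2 * y⌋₊ = 2 * ⌊y⌋₊ ∨ ⌊2 * y⌋₊ = 2 * ⌊y⌋₊ + 1 by omega) with h3 | h3
  · rw [h3, dist_self]; exact hδ
  · rw [h3] at hmem ⊢; exact h _ hmem.2

lemma DyadicGap.dist_proj_proj_le {k : ℕ} {δ : ℝ} (hδ : 0 ≤ δ) (h : DyadicGap a T x k δ)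
    {s t : ℝ≥0} (hs : s ∈ Set.Icc a T) (ht : t ∈ Set.Icc a T)
    (hst : |(t : ℝ) - s| ≤ (1 / 2) ^ k) :
    dist (x (dyadicProj a k t)) (x (dyadicProj a k s)) ≤ δ := by
  wlog hle : s ≤ t generalizing s t
  · rw [dist_comm]; rw [abs_sub_comm] at hst; exact this ht hs hst (le_of_not_ge hle)
  have hmem := dyadicProj_mem ht k
  unfold dyadicProj at hmem ⊢
  have h1 : ⌊(2 : ℝ≥0) ^ k * (s - a)⌋₊ ≤ ⌊(2 : ℝ≥0) ^ k * (t - a)⌋₊ :=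
    Nat.floor_mono (mul_le_mul_of_nonneg_left (tsub_le_tsub_right hle a) zero_le)
  have h2 : ⌊(2 : ℝ≥0) ^ k * (t - a)⌋₊ ≤ ⌊(2 : ℝ≥0) ^ k * (s - a)⌋₊ + 1 := by
    rw [← Nat.floor_add_one zero_le]
    refine Nat.floor_mono ?_
    rw [← NNReal.coe_le_coe]
    push_cast [NNReal.coe_sub hs.1, NNReal.coe_sub ht.1]
    have h3 : (0 : ℝ) < 2 ^ k := by positivity
    have h4 := (le_abs_self _).trans hst
    rw [one_div, inv_pow, ← one_div, le_div_iff₀ h3] at h4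
    nlinarith
  rcases (show ⌊(2 : ℝ≥0) ^ k * (t - a)⌋₊ = ⌊(2 : ℝ≥0) ^ k * (s - a)⌋₊ ∨
    ⌊(2 : ℝ≥0) ^ k * (t - a)⌋₊ = ⌊(2 : ℝ≥0) ^ k * (s - a)⌋₊ + 1 by omega) with h3 | h3
  · rw [h3, dist_self]; exact hδ
  · rw [h3] at hmem ⊢; exact h _ hmem.2

/-- Summed chaining bound. The hypothesis `hb` says that the gaps decay at least as fast as the
summable sequence `b`, uniformly in the starting level. -/
lemma dist_proj_add_le {m₀ : ℕ} {δ b : ℕ → ℝ} (hδ : ∀ k, 0 ≤ δ k) (hb0 : ∀ i, 0 ≤ b i)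
    (hbs : Summable b) (hb : ∀ m ≥ m₀, ∀ i, δ (m + i + 1) ≤ δ m * b i)
    (hgap : ∀ k ≥ m₀, DyadicGap a T x k (δ k)) {t : ℝ≥0} (ht : t ∈ Set.Icc a T) {m : ℕ}
    (hm : m₀ ≤ m) (n : ℕ) :
    dist (x (dyadicProj a (m + n) t)) (x (dyadicProj a m t)) ≤ δ m * ∑' i, b i := by
  have h1 : dist (x (dyadicProj a (m + n) t)) (x (dyadicProj a m t)) ≤
      ∑ i ∈ Finset.range n, δ m * b i := by
    rw [dist_comm]
    refine (dist_le_range_sum_dist (fun i => x (dyadicProj a (m + i) t)) n).trans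
      (Finset.sum_le_sum fun i _ => ?_)
    rw [dist_comm]
    exact ((hgap (m + i + 1) (by omega)).dist_proj_succ_le (hδ _) ht).trans (hb m hm i)
  refine h1.trans ?_
  rw [← Finset.mul_sum]
  exact mul_le_mul_of_nonneg_left (hbs.sum_le_tsum _ fun i _ => hb0 i) (hδ m)

lemma cauchySeq_dyadicProj {m₀ : ℕ} {δ b : ℕ → ℝ} (hδ : ∀ k, 0 ≤ δ k) (hb0 : ∀ i, 0 ≤ b i)
    (hbs : Summable b) (hb : ∀ m ≥ m₀, ∀ i, δ (m + i + 1) ≤ δ m * b i)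
    (hδ0 : Tendsto δ atTop (𝓝 0))
    (hgap : ∀ k ≥ m₀, DyadicGap a T x k (δ k)) {t : ℝ≥0} (ht : t ∈ Set.Icc a T) :
    CauchySeq fun k => x (dyadicProj a k t) := by
  rw [Metric.cauchySeq_iff']
  intro ε hε
  have h0 : Tendsto (fun m => δ m * ∑' i, b i) atTop (𝓝 0) := by simpa using hδ0.mul_const _
  obtain ⟨m, hm, hlt⟩ := ((eventually_ge_atTop m₀).and (h0.eventually (gt_mem_nhds hε))).exists
  refine ⟨m, fun n hn => ?_⟩
  obtain ⟨i, rfl⟩ := Nat.exists_eq_add_of_le hn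
  exact (dist_proj_add_le hδ hb0 hbs hb hgap ht hm i).trans_lt hlt

/-- A function that is the limit of its values along dyadic projections inherits a modulus of
continuity from the gaps. -/
lemma dist_le_of_dyadicGap {m₀ : ℕ} {δ b : ℕ → ℝ} (hδ : ∀ k, 0 ≤ δ k) (hb0 : ∀ i, 0 ≤ b i)
    (hbs : Summable b) (hb : ∀ m ≥ m₀, ∀ i, δ (m + i + 1) ≤ δ m * b i)
    (hgap : ∀ k ≥ m₀, DyadicGap a T x k (δ k)) {w : ℝ≥0 → E}
    (hw : ∀ t ∈ Set.Icc a T, Tendsto (fun k => x (dyadicProj a k t)) atTop (𝓝 (w t)))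
    {s t : ℝ≥0} (hs : s ∈ Set.Icc a T) (ht : t ∈ Set.Icc a T) {m : ℕ} (hm : m₀ ≤ m)
    (hst : |(t : ℝ) - s| ≤ (1 / 2) ^ m) :
    dist (w t) (w s) ≤ (1 + 2 * ∑' i, b i) * δ m := by
  have hlim : ∀ t ∈ Set.Icc a T, dist (w t) (x (dyadicProj a m t)) ≤ δ m * ∑' i, b i := by
    intro t ht
    refine le_of_tendsto ((hw t ht).dist tendsto_const_nhds)
      ((eventually_ge_atTop m).mono fun k hk => ?_)
    obtain ⟨i, rfl⟩ := Nat.exists_eq_add_of_le hk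
    exact dist_proj_add_le hδ hb0 hbs hb hgap ht hm i
  have h1 := hlim t ht
  have h2 := hlim s hs
  rw [dist_comm] at h2
  have h3 := (hgap m hm).dist_proj_proj_le (hδ m) hs ht hst
  have h4 := dist_triangle4 (w t) (x (dyadicProj a m t)) (x (dyadicProj a m s)) (w s)
  linarith

end Chaining

/-! ### The modulus of continuity `r^γ √log (1/r)` -/

/-- The gap `2^{-γk} √k` at level `k`: the standard deviation of a dyadic increment times the
square root of the logarithm of their number. -/
noncomputable def logGap (γ : ℝ) (k : ℕ) : ℝ := ((1 / 2 : ℝ) ^ γ) ^ k * √k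

/-- The decay `logGap γ (m + i + 1) / logGap γ m`, bounded uniformly in `m ≥ 1`. -/
noncomputable def logGapDecay (γ : ℝ) (i : ℕ) : ℝ := ((1 / 2 : ℝ) ^ γ) ^ (i + 1) * √(i + 2)

lemma logGap_nonneg (γ : ℝ) (k : ℕ) : 0 ≤ logGap γ k := by unfold logGap; positivity

lemma logGapDecay_nonneg (γ : ℝ) (k : ℕ) : 0 ≤ logGapDecay γ k := by unfold logGapDecay; positivity

lemma logGap_add_le (γ : ℝ) {m : ℕ} (hm : 1 ≤ m) (i : ℕ) :
    logGap γ (m + i + 1) ≤ logGap γ m * logGapDecay γ i := by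
  unfold logGap logGapDecay
  have h : √((m + i + 1 : ℕ) : ℝ) ≤ √m * √(i + 2) := by
    rw [← Real.sqrt_mul (Nat.cast_nonneg m)]
    refine Real.sqrt_le_sqrt ?_
    have : (1 : ℝ) ≤ m := by exact_mod_cast hm
    push_cast
    nlinarith [Nat.cast_nonneg (α := ℝ) i]
  calc _ ≤ ((1 / 2 : ℝ) ^ γ) ^ (m + i + 1) * (√m * √(i + 2)) :=
        mul_le_mul_of_nonneg_left h (by positivity)
    _ = _ := by rw [add_assoc, pow_add]; ring

lemma half_rpow_lt_one {γ : ℝ} (hγ : 0 < γ) : (1 / 2 : ℝ) ^ γ < 1 :=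
  Real.rpow_lt_one (by norm_num) (by norm_num) hγ

lemma summable_logGapDecay {γ : ℝ} (hγ : 0 < γ) : Summable (logGapDecay γ) := by
  have h0 : (0 : ℝ) ≤ (1 / 2 : ℝ) ^ γ := by positivity
  have hg := summable_pow_mul_geometric_of_norm_lt_one 1 (r := (1 / 2 : ℝ) ^ γ)
    (by rw [Real.norm_of_nonneg h0]; exact half_rpow_lt_one hγ)
  have hg' := (summable_nat_add_iff 1).2 hg
  have hgeo := (summable_nat_add_iff 1).2 (summable_geometric_of_lt_one h0 (half_rpow_lt_one hγ))
  refine Summable.of_nonneg_of_le (logGapDecay_nonneg γ) (fun i => ?_) (hg'.add hgeo)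
  have h1 : √((i : ℝ) + 2) ≤ (i : ℝ) + 1 + 1 := by
    rw [Real.sqrt_le_left (by positivity)]
    nlinarith [Nat.cast_nonneg (α := ℝ) i]
  unfold logGapDecay
  refine (mul_le_mul_of_nonneg_left h1 (by positivity)).trans_eq ?_
  push_cast; ring

lemma tendsto_logGap {γ : ℝ} (hγ : 0 < γ) : Tendsto (logGap γ) atTop (𝓝 0) := by
  have h := (summable_logGapDecay hγ).tendsto_atTop_zero.const_mul (logGap γ 1)
  rw [mul_zero] at h
  rw [← tendsto_add_atTop_iff_nat 2]
  refine squeeze_zero (fun _ => logGap_nonneg _ _) (fun i => ?_) h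
  have := logGap_add_le γ le_rfl i
  rwa [show 1 + i + 1 = i + 2 by ring] at this

/-- Conversion of the gap at the dyadic level of `h` into the modulus of continuity at `h`. -/
lemma logGap_le {γ h : ℝ} (hγ : 0 < γ) (hh : 0 < h) {m : ℕ} (hm1 : (1 / 2 : ℝ) ^ (m + 1) < h)
    (hm2 : h ≤ (1 / 2) ^ m) :
    logGap γ m ≤ 2 ^ γ / √(Real.log 2) * (h ^ γ * √(Real.log (1 / h))) := by
  have h2 : 0 < Real.log 2 := Real.log_pos one_lt_two
  have h1 : ((1 / 2 : ℝ) ^ γ) ^ m ≤ 2 ^ γ * h ^ γ := by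
    rw [← Real.mul_rpow (by norm_num) hh.le, ← Real.rpow_natCast, ← Real.rpow_mul (by norm_num),
      mul_comm γ, Real.rpow_mul (by norm_num), Real.rpow_natCast]
    refine Real.rpow_le_rpow (by positivity) ?_ hγ.le
    rw [pow_succ] at hm1; linarith
  have h3 : √(m : ℝ) ≤ √(Real.log (1 / h)) / √(Real.log 2) := by
    rw [← Real.sqrt_div' _ h2.le]
    refine Real.sqrt_le_sqrt ?_
    rw [le_div_iff₀ h2, ← Real.log_pow]
    refine Real.log_le_log (by positivity) ?_
    rw [le_one_div (by positivity) hh, ← one_div_pow]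
    exact hm2
  calc logGap γ m ≤ (2 ^ γ * h ^ γ) * (√(Real.log (1 / h)) / √(Real.log 2)) :=
        mul_le_mul h1 h3 (Real.sqrt_nonneg _) (by positivity)
    _ = _ := by ring

/-- The modulus constant `K` produced by gaps `κ 2^{-γk} √k`. -/
noncomputable def modulusConst (γ κ : ℝ) : ℝ :=
  (1 + 2 * ∑' i, logGapDecay γ i) * κ * (2 ^ γ / √(Real.log 2))

lemma modulusConst_pos {γ κ : ℝ} (hκ : 0 < κ) : 0 < modulusConst γ κ := by
  have h1 : 0 ≤ ∑' i, logGapDecay γ i := tsum_nonneg (logGapDecay_nonneg γ)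
  have h2 : 0 < Real.log 2 := Real.log_pos one_lt_two
  unfold modulusConst
  positivity

section Modulus
variable {E : Type*} [NormedAddCommGroup E] {a T : ℝ≥0} {x : ℝ≥0 → E} {γ κ : ℝ} {m₀ : ℕ}

lemma const_mul_logGap_add_le (hκ : 0 ≤ κ) (hm₀ : 1 ≤ m₀) :
    ∀ m ≥ m₀, ∀ i, κ * logGap γ (m + i + 1) ≤ κ * logGap γ m * logGapDecay γ i :=
  fun m hm i => by
    rw [mul_assoc]
    exact mul_le_mul_of_nonneg_left (logGap_add_le γ (hm₀.trans hm) i) hκ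

lemma exists_modulus_of_dyadicGap (hγ : 0 < γ) (hκ : 0 ≤ κ) (hm₀ : 1 ≤ m₀)
    (hgap : ∀ k ≥ m₀, DyadicGap a T x k (κ * logGap γ k)) {w : ℝ≥0 → E}
    (hw : ∀ t ∈ Set.Icc a T, Tendsto (fun k => x (dyadicProj a k t)) atTop (𝓝 (w t))) :
    ∃ ε > (0 : ℝ), ∀ s ∈ Set.Icc a T, ∀ t ∈ Set.Icc a T,
      0 < |(t : ℝ) - s| → |(t : ℝ) - s| < ε →
      ‖w t - w s‖ ≤ modulusConst γ κ *
        (|(t : ℝ) - s| ^ γ * √(Real.log (1 / |(t : ℝ) - s|))) := by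
  refine ⟨(1 / 2) ^ m₀, by positivity, fun s hs t ht hst hlt => ?_⟩
  obtain ⟨m, hm1, hm2⟩ := exists_nat_pow_near_of_lt_one hst
    (hlt.le.trans (pow_le_one₀ (by norm_num) (by norm_num))) (y := (1 / 2 : ℝ)) (by norm_num)
    (by norm_num)
  have hm : m₀ ≤ m := by
    have := (pow_lt_pow_iff_right_of_lt_one₀ (by norm_num : (0 : ℝ) < 1 / 2) (by norm_num)).1
      (hm1.trans hlt)
    omega
  have h := dist_le_of_dyadicGap (fun k => mul_nonneg hκ (logGap_nonneg γ k))
    (logGapDecay_nonneg γ) (summable_logGapDecay hγ) (const_mul_logGap_add_le hκ hm₀) hgap hw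
    hs ht hm hm2
  rw [dist_eq_norm] at h
  have h1 : 0 ≤ ∑' i, logGapDecay γ i := tsum_nonneg (logGapDecay_nonneg γ)
  calc _ ≤ (1 + 2 * ∑' i, logGapDecay γ i) * (κ * logGap γ m) := h
    _ ≤ (1 + 2 * ∑' i, logGapDecay γ i) * (κ * (2 ^ γ / √(Real.log 2) *
        (|(t : ℝ) - s| ^ γ * √(Real.log (1 / |(t : ℝ) - s|))))) := by
        gcongr; exact logGap_le hγ hst hm1 hm2
    _ = _ := by unfold modulusConst; ring

lemma continuousOn_of_dyadicGap (hγ : 0 < γ) (hκ : 0 ≤ κ) (hm₀ : 1 ≤ m₀)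
    (hgap : ∀ k ≥ m₀, DyadicGap a T x k (κ * logGap γ k)) {w : ℝ≥0 → E}
    (hw : ∀ t ∈ Set.Icc a T, Tendsto (fun k => x (dyadicProj a k t)) atTop (𝓝 (w t))) :
    ContinuousOn w (Set.Icc a T) := by
  rw [Metric.continuousOn_iff]
  intro t ht ε hε
  have h0 : Tendsto (fun m => (1 + 2 * ∑' i, logGapDecay γ i) * (κ * logGap γ m)) atTop (𝓝 0) := by
    simpa using ((tendsto_logGap hγ).const_mul κ).const_mul (1 + 2 * ∑' i, logGapDecay γ i)
  obtain ⟨m, hm, hlt⟩ := ((eventually_ge_atTop m₀).and (h0.eventually (gt_mem_nhds hε))).exists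
  refine ⟨(1 / 2) ^ m, by positivity, fun s hs hst => ?_⟩
  rw [NNReal.dist_eq] at hst
  exact (dist_le_of_dyadicGap (fun k => mul_nonneg hκ (logGap_nonneg γ k))
    (logGapDecay_nonneg γ) (summable_logGapDecay hγ) (const_mul_logGap_add_le hκ hm₀) hgap hw
    ht hs hm hst.le).trans_lt hlt

lemma exists_rpow_mul_sqrt_log_le {e : ℝ} (he : 0 < e) :
    ∃ C > 0, ∀ h > 0, h ≤ 1 → h ^ e * √(Real.log (1 / h)) ≤ C := by
  refine ⟨√(1 / (2 * e)), by positivity, fun h hh hh1 => ?_⟩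
  have h1 : Real.log (1 / h) ≤ (1 / h) ^ (2 * e) / (2 * e) :=
    Real.log_le_rpow_div (by positivity) (by positivity)
  rw [show h ^ e = √(h ^ (2 * e)) by
    rw [mul_comm, Real.rpow_mul hh.le, Real.rpow_two, Real.sqrt_sq (Real.rpow_nonneg hh.le _)],
    ← Real.sqrt_mul (Real.rpow_nonneg hh.le _)]
  refine Real.sqrt_le_sqrt ((mul_le_mul_of_nonneg_left h1 (Real.rpow_nonneg hh.le _)).trans_eq ?_)
  rw [one_div, Real.inv_rpow hh.le]
  have : h ^ (2 * e) ≠ 0 := (Real.rpow_pos_of_pos hh _).ne'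
  field_simp

/-- The logarithmic modulus of continuity at small distances implies Hölder continuity of all
smaller exponents; compactness takes care of the large distances. -/
lemma exists_holderOnWith_of_modulus {w : ℝ≥0 → E} (hc : ContinuousOn w (Set.Icc a T)) {K ε : ℝ}
    (hK : 0 ≤ K) (hε : 0 < ε)
    (hmod : ∀ s ∈ Set.Icc a T, ∀ t ∈ Set.Icc a T, 0 < |(t : ℝ) - s| → |(t : ℝ) - s| < ε →
      ‖w t - w s‖ ≤ K * (|(t : ℝ) - s| ^ γ * √(Real.log (1 / |(t : ℝ) - s|))))
    {b : ℝ≥0} (hb : 0 < b) (hbγ : (b : ℝ) < γ) :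
    ∃ L : ℝ≥0, HolderOnWith L b w (Set.Icc a T) := by
  obtain ⟨C, hC, hClog⟩ := exists_rpow_mul_sqrt_log_le (sub_pos.2 hbγ)
  obtain ⟨R, hR⟩ := isCompact_Icc.exists_bound_of_continuousOn hc
  have hb0 : (0 : ℝ) < b := hb
  set ε' := min ε 1 with hε'
  have hε'0 : 0 < ε' := lt_min hε one_pos
  set L := max (K * C) (2 * |R| / ε' ^ (b : ℝ)) with hL
  have hL0 : 0 ≤ L := (mul_nonneg hK hC.le).trans (le_max_left _ _)
  refine ⟨L.toNNReal, fun s hs t ht => ?_⟩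
  have hdist : dist (w s) (w t) ≤ L * dist s t ^ (b : ℝ) := by
    rw [dist_comm, dist_comm s, dist_eq_norm, NNReal.dist_eq]
    set h := |(t : ℝ) - s| with hh
    rcases (abs_nonneg ((t : ℝ) - s)).eq_or_lt with h0 | h0
    · have : t = s := NNReal.coe_injective (sub_eq_zero.1 (abs_eq_zero.1 h0.symm))
      subst this
      rw [sub_self, norm_zero]; positivity
    rcases lt_or_ge h ε' with hlt | hge
    · have h1 : h ≤ 1 := hlt.le.trans (min_le_right _ _)
      calc ‖w t - w s‖ ≤ K * (h ^ γ * √(Real.log (1 / h))) :=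
            hmod s hs t ht h0 (hlt.trans_le (min_le_left _ _))
        _ = K * (h ^ (γ - b) * √(Real.log (1 / h))) * h ^ (b : ℝ) := by
            rw [show h ^ γ = h ^ (γ - b) * h ^ (b : ℝ) by
              rw [← Real.rpow_add h0, sub_add_cancel]]
            ring
        _ ≤ K * C * h ^ (b : ℝ) := by gcongr; exact hClog h h0 h1
        _ ≤ L * h ^ (b : ℝ) := by gcongr; exact le_max_left _ _
    · calc ‖w t - w s‖ ≤ ‖w t‖ + ‖w s‖ := norm_sub_le _ _
        _ ≤ 2 * |R| := by linarith [hR t ht, hR s hs, le_abs_self R]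
        _ = 2 * |R| / ε' ^ (b : ℝ) * ε' ^ (b : ℝ) := by field_simp
        _ ≤ L * h ^ (b : ℝ) := by gcongr; exact le_max_right _ _
  rw [edist_dist, edist_dist, ENNReal.ofReal_rpow_of_nonneg dist_nonneg hb0.le,
    ← ENNReal.ofReal, ← ENNReal.ofReal_mul hL0]
  exact ENNReal.ofReal_le_ofReal hdist

end Modulus

/-! ### Continuous versions of processes with sub-Gaussian increments -/

lemma exists_le_abs_of_lt_norm {d : ℕ} (hd : 1 ≤ d) {r : ℝ} (hr : 0 ≤ r)
    {z : EuclideanSpace ℝ (Fin d)} (h : r < ‖z‖) : ∃ i, r / √d ≤ |z i| := by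
  by_contra! hcon
  have hd0 : (0 : ℝ) < d := by exact_mod_cast hd
  have h1 : ‖z‖ ^ 2 ≤ r ^ 2 := by
    rw [EuclideanSpace.norm_sq_eq]
    calc ∑ i, ‖z i‖ ^ 2 ≤ ∑ _i : Fin d, (r / √d) ^ 2 :=
          Finset.sum_le_sum fun i _ => pow_le_pow_left₀ (norm_nonneg _) (hcon i).le 2
      _ = r ^ 2 := by
          rw [Finset.sum_const, Finset.card_univ, Fintype.card_fin, nsmul_eq_mul, div_pow,
            Real.sq_sqrt hd0.le]
          field_simp
  exact absurd h (not_lt.2 ((pow_le_pow_iff_left₀ (norm_nonneg _) hr two_ne_zero).1 h1))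

section Version
variable {Ω : Type*} [MeasurableSpace Ω] {μ : Measure Ω} {d : ℕ}
  {X : ℝ≥0 → Ω → EuclideanSpace ℝ (Fin d)} {a T : ℝ≥0} {γ C : ℝ}

/-- On `[a,T]` the increments of each coordinate of `X` over a time `h ≤ 1` are strictly
sub-Gaussian with variance at most `C h^{2γ}`. -/
def HasSubgaussianIncrements (μ : Measure Ω) (X : ℝ≥0 → Ω → EuclideanSpace ℝ (Fin d))
    (a T : ℝ≥0) (γ C : ℝ) : Prop :=
  ∀ s ∈ Set.Icc a T, ∀ t ∈ Set.Icc a T, 0 < |(t : ℝ) - s| → |(t : ℝ) - s| ≤ 1 → ∀ i,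
    IsStrictlySubgaussian (fun ω => X t ω i - X s ω i) μ ∧
      ∫ ω, ‖X t ω i - X s ω i‖ ^ 2 ∂μ ≤ C * (|(t : ℝ) - s| ^ γ) ^ 2

lemma HasSubgaussianIncrements.measure_lt_norm_sub_le [IsFiniteMeasure μ] (hd : 1 ≤ d) (hC : 0 < C)
    (hX : HasSubgaussianIncrements μ X a T γ C) {s t : ℝ≥0} (hs : s ∈ Set.Icc a T)
    (ht : t ∈ Set.Icc a T) (hst : 0 < |(t : ℝ) - s|) (hst1 : |(t : ℝ) - s| ≤ 1) {r : ℝ}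
    (hr : 0 ≤ r) :
    μ {ω | r < ‖X t ω - X s ω‖} ≤ ENNReal.ofReal
      (d * (2 * Real.exp (-r ^ 2 / (2 * (d * C * (|(t : ℝ) - s| ^ γ) ^ 2))))) := by
  have hsub : {ω | r < ‖X t ω - X s ω‖} ⊆ ⋃ i, {ω | r / √d ≤ |X t ω i - X s ω i|} :=
    fun ω hω => by
      obtain ⟨i, hi⟩ := exists_le_abs_of_lt_norm hd hr hω
      exact Set.mem_iUnion.2 ⟨i, hi⟩
  have hd0 : (0 : ℝ) < d := by exact_mod_cast hd
  have hpow : 0 < |(t : ℝ) - s| ^ γ := Real.rpow_pos_of_pos hst γ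
  have hi : ∀ i, μ {ω | r / √d ≤ |X t ω i - X s ω i|} ≤ ENNReal.ofReal
      (2 * Real.exp (-r ^ 2 / (2 * (d * C * (|(t : ℝ) - s| ^ γ) ^ 2)))) := fun i => by
    obtain ⟨h1, h2⟩ := hX s hs t ht hst hst1 i
    refine (h1.measure_abs_ge_le (by positivity) h2 (by positivity)).trans_eq ?_
    congr 3
    rw [div_pow, Real.sq_sqrt hd0.le]
    field_simp
  refine (measure_mono hsub).trans ((measure_iUnion_fintype_le _ _).trans ?_)
  refine (Finset.sum_le_sum fun i _ => hi i).trans_eq ?_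
  rw [Finset.sum_const, Finset.card_univ, Fintype.card_fin, nsmul_eq_mul,
    ENNReal.ofReal_mul hd0.le, ENNReal.ofReal_natCast]

/-- The constant of the level-`k` gaps: it makes the union bound over the `O(2^k)` dyadic
increments of level `k` at most `O(2^k e^{-2k})`. -/
noncomputable def gapConst (d : ℕ) (C : ℝ) : ℝ := 2 * √(d * C)

lemma HasSubgaussianIncrements.measure_not_dyadicGap_le [IsFiniteMeasure μ] (hd : 1 ≤ d)
    (hC : 0 < C) (hX : HasSubgaussianIncrements μ X a T γ C) (k : ℕ) :
    μ {ω | ¬ DyadicGap a T (fun t => X t ω) k (gapConst d C * logGap γ k)} ≤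
      ENNReal.ofReal (⌈T⌉₊ * d * 2 * (2 * Real.exp (-2)) ^ k) := by
  classical
  set r := gapConst d C * logGap γ k with hr
  have hr0 : 0 ≤ r := mul_nonneg (by unfold gapConst; positivity) (logGap_nonneg γ k)
  set J := (Finset.range (⌈T⌉₊ * 2 ^ k)).filter fun j => dyadicPoint a k (j + 1) ≤ T with hJ
  have hdC : (0 : ℝ) < d * C := mul_pos (by exact_mod_cast hd) hC
  have hsub : {ω | ¬ DyadicGap a T (fun t => X t ω) k r} ⊆
      ⋃ j ∈ J, {ω | r < ‖X (dyadicPoint a k (j + 1)) ω - X (dyadicPoint a k j) ω‖} := by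
    intro ω hω
    simp only [DyadicGap, Set.mem_ofPred_eq, not_forall, not_le, dist_eq_norm] at hω
    obtain ⟨j, hjT, hj⟩ := hω
    refine Set.mem_biUnion (x := j) ?_ hj
    have h1 : ((j + 1 : ℕ) : ℝ≥0) / 2 ^ k ≤ ⌈T⌉₊ :=
      (le_add_self.trans hjT).trans (Nat.le_ceil T)
    rw [div_le_iff₀ (by positivity)] at h1
    have h2 : j + 1 ≤ ⌈T⌉₊ * 2 ^ k := by exact_mod_cast h1
    simp only [hJ, Finset.coe_filter, Finset.mem_range, Set.mem_ofPred_eq]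
    exact ⟨by omega, hjT⟩
  have hterm : ∀ j ∈ J, μ {ω | r < ‖X (dyadicPoint a k (j + 1)) ω - X (dyadicPoint a k j) ω‖} ≤
      ENNReal.ofReal (d * (2 * Real.exp (-2) ^ k)) := fun j hj => by
    have hjT := (Finset.mem_filter.1 hj).2
    have hdiff : |((dyadicPoint a k (j + 1) : ℝ≥0) : ℝ) - dyadicPoint a k j| = (1 / 2) ^ k := by
      unfold dyadicPoint
      push_cast
      rw [add_sub_add_left_eq_sub, ← sub_div, add_sub_cancel_left, abs_of_pos (by positivity),
        one_div_pow]
    have h := hX.measure_lt_norm_sub_le hd hC (s := dyadicPoint a k j)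
      (t := dyadicPoint a k (j + 1)) ⟨le_self_add, (dyadicPoint_mono a k j.le_succ).trans hjT⟩
      ⟨le_self_add, hjT⟩ (by rw [hdiff]; positivity)
      (by rw [hdiff]; exact pow_le_one₀ (by norm_num) (by norm_num)) hr0
    refine h.trans_eq ?_
    rw [hdiff, ← Real.exp_nat_mul]
    congr 4
    have hpow : ((1 / 2 : ℝ) ^ k) ^ γ = ((1 / 2 : ℝ) ^ γ) ^ k := by
      rw [← Real.rpow_natCast, ← Real.rpow_natCast, ← Real.rpow_mul (by norm_num),
        ← Real.rpow_mul (by norm_num), mul_comm]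
    have hρ : (0 : ℝ) < ((1 / 2 : ℝ) ^ γ) ^ k := by positivity
    rw [hr, gapConst, logGap, hpow, mul_pow, mul_pow, mul_pow, Real.sq_sqrt hdC.le,
      Real.sq_sqrt (Nat.cast_nonneg k), div_eq_iff (by positivity)]
    ring
  refine (measure_mono hsub).trans ((measure_biUnion_finset_le _ _).trans
    ((Finset.sum_le_sum hterm).trans ?_))
  rw [Finset.sum_const, nsmul_eq_mul, ← ENNReal.ofReal_natCast,
    ← ENNReal.ofReal_mul (Nat.cast_nonneg _)]
  refine ENNReal.ofReal_le_ofReal ?_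
  have hcard : (J.card : ℝ) ≤ ⌈T⌉₊ * 2 ^ k := by
    have := Finset.card_filter_le (Finset.range (⌈T⌉₊ * 2 ^ k))
      fun j => dyadicPoint a k (j + 1) ≤ T
    rw [Finset.card_range] at this
    exact_mod_cast this
  calc _ ≤ (⌈T⌉₊ * 2 ^ k : ℝ) * (d * (2 * Real.exp (-2) ^ k)) :=
        mul_le_mul_of_nonneg_right hcard (by positivity)
    _ = _ := by rw [mul_pow]; ring

lemma HasSubgaussianIncrements.ae_dyadicGap [IsFiniteMeasure μ] (hd : 1 ≤ d)
    (hC : 0 < C) (hX : HasSubgaussianIncrements μ X a T γ C) :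
    ∀ᵐ ω ∂μ, ∃ m₀ ≥ 1, ∀ k ≥ m₀,
      DyadicGap a T (fun t => X t ω) k (gapConst d C * logGap γ k) := by
  have hlt : 2 * Real.exp (-2) < 1 := by
    have h1 : (3 : ℝ) ≤ Real.exp 2 := by linarith [Real.add_one_le_exp (2 : ℝ)]
    rw [Real.exp_neg, ← div_eq_mul_inv, div_lt_one (Real.exp_pos 2)]
    linarith
  have hs : Summable fun k : ℕ => (⌈T⌉₊ * d * 2 : ℝ) * (2 * Real.exp (-2)) ^ k :=
    (summable_geometric_of_lt_one (by positivity) hlt).mul_left _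
  have hsum : ∑' k, μ {ω | ¬ DyadicGap a T (fun t => X t ω) k (gapConst d C * logGap γ k)} ≠ ∞ :=
    ne_top_of_le_ne_top hs.tsum_ofReal_ne_top
      (ENNReal.tsum_le_tsum fun k => hX.measure_not_dyadicGap_le hd hC k)
  filter_upwards [ae_eventually_notMem hsum] with ω hω
  obtain ⟨m, hm⟩ := eventually_atTop.1 hω
  exact ⟨max m 1, le_max_right _ _, fun k hk => not_not.1 (hm k ((le_max_left _ _).trans hk))⟩

/-- Almost surely along a subsequence, the values at the dyadic projections of a fixed time `t`
converge to the value at `t`. -/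
lemma HasSubgaussianIncrements.exists_seq_tendsto_ae (hγ : 0 < γ)
    (hXm : ∀ t, MemLp (X t) 2 μ) (hX : HasSubgaussianIncrements μ X a T γ C) {t : ℝ≥0}
    (ht : t ∈ Set.Icc a T) :
    ∃ ns : ℕ → ℕ, StrictMono ns ∧
      ∀ᵐ ω ∂μ, Tendsto (fun k => X (dyadicProj a (ns k) t) ω) atTop (𝓝 (X t ω)) := by
  have hcoord : ∀ s i, MemLp (fun ω => X t ω i - X s ω i) 2 μ := fun s i =>
    ((hXm t).sub (hXm s)).continuousLinearMap_comp (EuclideanSpace.proj (𝕜 := ℝ) i)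
  have hsq : ∀ k, ∫ ω, ‖X t ω - X (dyadicProj a k t) ω‖ ^ 2 ∂μ ≤
      d * (|C| * (((1 / 2 : ℝ) ^ k) ^ γ) ^ 2) := fun k => by
    have hC0 : 0 ≤ |C| * (((1 / 2 : ℝ) ^ k) ^ γ) ^ 2 := by positivity
    have hle := sub_dyadicProj_le ht.1 k
    simp_rw [EuclideanSpace.norm_sq_eq, PiLp.sub_apply]
    rw [integral_finsetSum _ fun i _ => (hcoord _ i).integrable_norm_pow two_ne_zero]
    refine (Finset.sum_le_card_nsmul _ _ (|C| * (((1 / 2 : ℝ) ^ k) ^ γ) ^ 2)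
      fun i _ => ?_).trans_eq (by simp)
    rcases (abs_nonneg ((t : ℝ) - dyadicProj a k t)).eq_or_lt with h0 | h0
    · have : t = dyadicProj a k t := NNReal.coe_injective (sub_eq_zero.1 (abs_eq_zero.1 h0.symm))
      rw [← this]
      simpa using hC0
    · refine ((hX _ (dyadicProj_mem ht k) t ht h0
        (hle.trans (pow_le_one₀ (by norm_num) (by norm_num))) i).2).trans ?_
      exact mul_le_mul (le_abs_self C) (pow_le_pow_left₀ (by positivity)
        (Real.rpow_le_rpow h0.le hle hγ.le) 2) (by positivity) (abs_nonneg C)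
  have hlim : Tendsto (fun k : ℕ => (d : ℝ) * (|C| * (((1 / 2 : ℝ) ^ k) ^ γ) ^ 2)) atTop (𝓝 0) := by
    have h1 := tendsto_pow_atTop_nhds_zero_of_lt_one (r := (1 / 2 : ℝ)) (by norm_num) (by norm_num)
    have h2 := (((h1.rpow_const (Or.inr hγ.le)).pow 2).const_mul |C|).const_mul (d : ℝ)
    simpa [Real.zero_rpow hγ.ne'] using h2
  have hL2 : Tendsto (fun k => eLpNorm (X (dyadicProj a k t) - X t) 2 μ) atTop (𝓝 0) := by
    have h1 := squeeze_zero (fun k => integral_nonneg fun ω => by positivity) hsq hlim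
    have h2 := ENNReal.tendsto_ofReal ((Real.continuous_sqrt.tendsto _).comp h1)
    rw [Real.sqrt_zero, ENNReal.ofReal_zero] at h2
    refine h2.congr fun k => ?_
    rw [eLpNorm_sub_comm]
    exact (eLpNorm_two_eq_ofReal ((hXm t).sub (hXm (dyadicProj a k t)))).symm
  exact (tendstoInMeasure_of_tendsto_eLpNorm (by norm_num) (fun k => (hXm _).1)
    (hXm t).1 hL2).exists_seq_tendsto_ae

lemma gapConst_pos (hd : 1 ≤ d) (hC : 0 < C) : 0 < gapConst d C := by
  have : (0 : ℝ) < d := by exact_mod_cast hd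
  unfold gapConst; positivity

/-- The continuous version is the limit of the process along the dyadic projections. -/
lemma HasSubgaussianIncrements.exists_isContinuousVersionOn [IsFiniteMeasure μ] (hd : 1 ≤ d)
    (hC : 0 < C) (hγ : 0 < γ) (hXm : ∀ t, MemLp (X t) 2 μ)
    (hX : HasSubgaussianIncrements μ X a T γ C) :
    ∃ v, IsContinuousVersionOn μ a T X v := by
  have hgap := hX.ae_dyadicGap hd hC
  have hκ := (gapConst_pos hd hC).le
  have htend : ∀ᵐ ω ∂μ, ∀ t ∈ Set.Icc a T, Tendsto (fun k => X (dyadicProj a k t) ω) atTop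
      (𝓝 (limUnder atTop fun k => X (dyadicProj a k t) ω)) := by
    filter_upwards [hgap] with ω hω t ht
    obtain ⟨m₀, hm₀, hg⟩ := hω
    exact (cauchySeq_dyadicProj (x := fun t => X t ω)
      (fun k => mul_nonneg hκ (logGap_nonneg γ k))
      (logGapDecay_nonneg γ) (summable_logGapDecay hγ) (const_mul_logGap_add_le hκ hm₀)
      (by simpa using (tendsto_logGap hγ).const_mul (gapConst d C)) hg ht).tendsto_limUnder
  refine ⟨fun t ω => limUnder atTop fun k => X (dyadicProj a k t) ω, fun t ht => ?_, ?_⟩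
  · obtain ⟨ns, hns, hae⟩ := hX.exists_seq_tendsto_ae hγ hXm ht
    filter_upwards [htend, hae] with ω h1 h2
    exact tendsto_nhds_unique ((h1 t ht).comp hns.tendsto_atTop) h2
  · filter_upwards [htend, hgap] with ω h1 h2
    obtain ⟨m₀, hm₀, hg⟩ := h2
    exact continuousOn_of_dyadicGap (x := fun t => X t ω) hγ hκ hm₀ hg h1

/-- A continuous version agrees with the process at all dyadic points simultaneously, hence it is
the limit of the process along the dyadic projections. -/
lemma IsContinuousVersionOn.ae_tendsto_dyadicProj {E : Type*} [TopologicalSpace E]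
    {Y v : ℝ≥0 → Ω → E} (hv : IsContinuousVersionOn μ a T Y v) :
    ∀ᵐ ω ∂μ, ∀ t ∈ Set.Icc a T,
      Tendsto (fun k => Y (dyadicProj a k t) ω) atTop (𝓝 (v t ω)) := by
  have hgrid : ∀ᵐ ω ∂μ, ∀ k j, dyadicPoint a k j ∈ Set.Icc a T →
      v (dyadicPoint a k j) ω = Y (dyadicPoint a k j) ω := by
    rw [ae_all_iff]; intro k
    rw [ae_all_iff]; intro j
    by_cases h : dyadicPoint a k j ∈ Set.Icc a T
    · filter_upwards [hv.1 _ h] with ω hω _ using hω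
    · exact Eventually.of_forall fun ω h' => absurd h' h
  filter_upwards [hgrid, hv.2] with ω h1 h2 t ht
  have h3 : Tendsto (fun k => v (dyadicProj a k t) ω) atTop (𝓝 (v t ω)) :=
    (h2 t ht).tendsto.comp (tendsto_nhdsWithin_iff.2
      ⟨tendsto_dyadicProj ht.1, Eventually.of_forall fun k => dyadicProj_mem ht k⟩)
  exact h3.congr fun k => h1 _ _ (dyadicProj_mem ht k)

lemma HasSubgaussianIncrements.ae_modulus [IsFiniteMeasure μ] (hd : 1 ≤ d)
    (hC : 0 < C) (hγ : 0 < γ) (hX : HasSubgaussianIncrements μ X a T γ C)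
    {v : ℝ≥0 → Ω → EuclideanSpace ℝ (Fin d)} (hv : IsContinuousVersionOn μ a T X v) :
    ∀ᵐ ω ∂μ, ∃ ε > (0 : ℝ), ∀ s ∈ Set.Icc a T, ∀ t ∈ Set.Icc a T,
      0 < |(t : ℝ) - s| → |(t : ℝ) - s| < ε →
      ‖v t ω - v s ω‖ ≤ modulusConst γ (gapConst d C) *
        (|(t : ℝ) - s| ^ γ * √(Real.log (1 / |(t : ℝ) - s|))) := by
  filter_upwards [hX.ae_dyadicGap hd hC, hv.ae_tendsto_dyadicProj] with ω h1 h2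
  obtain ⟨m₀, hm₀, hg⟩ := h1
  exact exists_modulus_of_dyadicGap (x := fun t => X t ω) (w := fun t => v t ω) hγ
    (gapConst_pos hd hC).le hm₀ hg h2

lemma HasSubgaussianIncrements.ae_holderOnWith [IsFiniteMeasure μ] (hd : 1 ≤ d)
    (hC : 0 < C) (hγ : 0 < γ) (hX : HasSubgaussianIncrements μ X a T γ C)
    {v : ℝ≥0 → Ω → EuclideanSpace ℝ (Fin d)} (hv : IsContinuousVersionOn μ a T X v) :
    ∀ᵐ ω ∂μ, ∀ b : ℝ≥0, 0 < b → (b : ℝ) < γ →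
      ∃ L : ℝ≥0, HolderOnWith L b (fun t => v t ω) (Set.Icc a T) := by
  filter_upwards [hX.ae_modulus hd hC hγ hv, hv.2] with ω h1 h2 b hb hbγ
  obtain ⟨ε, hε, hmod⟩ := h1
  exact exists_holderOnWith_of_modulus h2 (modulusConst_pos (gapConst_pos hd hC)).le hε hmod hb hbγ

end Version

/-! ### Increments of the mild solution -/

section Solution
variable {Ω : Type*} [MeasurableSpace Ω] {μ : Measure Ω} {d : ℕ} {H : ℝ}
  {q : ℕ → ℝ} {β β' : Fin d → ℕ → ℝ≥0 → Ω → ℝ} {u : ℝ≥0 → Real.Angle → Ω → EuclideanSpace ℝ (Fin d)}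

lemma IsMildSolution.memLp_apply_sub (hu : IsMildSolution q β β' μ u) (x : Real.Angle)
    (s t : ℝ≥0) (i : Fin d) : MemLp (fun ω => u t x ω i - u s x ω i) 2 μ :=
  ((hu.1 t x).sub (hu.1 s x)).continuousLinearMap_comp (EuclideanSpace.proj (𝕜 := ℝ) i)

/-- Each coordinate of an increment is strictly sub-Gaussian, and its variance is the sum over the
modes of `qₙ` times the variance of the mode. The variance does not depend on `x`, since `cos² + sin² = 1`. -/
lemma IsMildSolution.increment [IsProbabilityMeasure μ] (hH : H ∈ Set.Ioo (0 : ℝ) 1) (hq : ∀ n, 0 ≤ q n)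
    (hβ : IsDrivingNoise H β β' μ) (hu : IsMildSolution q β β' μ u) (x : Real.Angle)
    (s t : ℝ≥0) (i : Fin d) :
    IsStrictlySubgaussian (fun ω => u t x ω i - u s x ω i) μ ∧
    Tendsto (fun N : ℕ => ∑ n ∈ Finset.range N, q n * incrementVar H ((n : ℝ) ^ 2) s t) atTop
      (𝓝 (∫ ω, ‖u t x ω i - u s x ω i‖ ^ 2 ∂μ)) := by
  have hmem := hu.memLp_apply_sub x s t i
  obtain ⟨hu2, I, I', hI, hI', hser⟩ := hu
  let B : ℕ ⊕ ℕ → ℝ≥0 → Ω → ℝ := Sum.elim (β i) (β' i)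
  let D : ℕ ⊕ ℕ → Ω → ℝ := Sum.elim (fun n ω => I i n t ω - I i n s ω)
    (fun n ω => I' i n t ω - I' i n s ω)
  let w : ℕ ⊕ ℕ → ℝ := Sum.elim (fun n => √(q n) * Real.Angle.cos (n • x))
    (fun n => √(q n) * Real.Angle.sin (n • x))
  let Ψ : ℕ ⊕ ℕ → ℝ → ℂ := fun j ξ =>
    heatSymbol (((Sum.elim id id j : ℕ) : ℝ) ^ 2) t ξ -
      heatSymbol (((Sum.elim id id j : ℕ) : ℝ) ^ 2) s ξ
  have hB : ∀ j, IsFractionalBM H (B j) μ := by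
    rintro (n | n)
    exacts [hβ.fbm i n, hβ.fbm' i n]
  have hD : ∀ j, MemLp (D j) 2 μ := by
    rintro (n | n)
    exacts [(hI i n t).1.sub (hI i n s).1, (hI' i n t).1.sub (hI' i n s).1]
  -- one index set `ℕ ⊕ ℕ` for the noises of the cosine and of the sine modes of coordinate `i`
  have hind : iIndepFun (fun j ω (r : ℝ≥0) => B j r ω) μ := by
    have hinj : Function.Injective (Sum.map (fun n : ℕ => (i, n)) fun n : ℕ => (i, n)) :=
      Function.Injective.sumMap (Prod.mk_right_injective i) (Prod.mk_right_injective i)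
    convert hβ.indep.precomp hinj using 1
    funext j
    rcases j with n | n <;> rfl
  have hc : ∀ j, ∃ c : ℕ → (ℝ≥0 →₀ ℝ),
      Tendsto (fun k => eLpNorm (fun ω => stepIntegral (B j) (c k) ω - D j ω) 2 μ) atTop (𝓝 0) ∧
      ∀ ξ, Tendsto (fun k => stepSymbol (c k) ξ) atTop (𝓝 (Ψ j ξ)) := by
    rintro (n | n)
    exacts [exists_stepIntegral_tendsto_sub (hβ.fbm i n) (hI i n t) (hI i n s),
      exists_stepIntegral_tendsto_sub (hβ.fbm' i n) (hI' i n t) (hI' i n s)]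
  choose c hcD hcΨ using hc
  have hiso := fun N : ℕ => isStrictlySubgaussian_sum_of_tendsto hH hB hind
    ((Finset.range N).disjSum (Finset.range N)) w hD hcD hcΨ
  have hvar : ∀ N : ℕ, ∑ j ∈ (Finset.range N).disjSum (Finset.range N),
      w j ^ 2 * ∫ ξ, ‖Ψ j ξ‖ ^ 2 ∂spectralMeasure H =
        ∑ n ∈ Finset.range N, q n * incrementVar H ((n : ℝ) ^ 2) s t := fun N => by
    rw [Finset.sum_disjSum, ← Finset.sum_add_distrib]
    refine Finset.sum_congr rfl fun n _ => ?_
    change (√(q n) * Real.Angle.cos (n • x)) ^ 2 * incrementVar H ((n : ℝ) ^ 2) s t +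
      (√(q n) * Real.Angle.sin (n • x)) ^ 2 * incrementVar H ((n : ℝ) ^ 2) s t = _
    rw [mul_pow, mul_pow, Real.sq_sqrt (hq n), ← add_mul, ← mul_add,
      Real.Angle.cos_sq_add_sin_sq, mul_one]
  have hlim : Tendsto (fun N : ℕ => eLpNorm (fun ω =>
      (∑ j ∈ (Finset.range N).disjSum (Finset.range N), w j * D j ω) -
        (u t x ω i - u s x ω i)) 2 μ) atTop (𝓝 0) := by
    have h0 := (hser t x i).add (hser s x i)
    rw [add_zero] at h0
    have hpart : ∀ (r : ℝ≥0) (N : ℕ), AEStronglyMeasurable (fun ω => u r x ω i -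
        ∑ n ∈ Finset.range N, √(q n) *
          (Real.Angle.cos (n • x) * I i n r ω + Real.Angle.sin (n • x) * I' i n r ω)) μ := by
      intro r N
      have hur : AEStronglyMeasurable (fun ω => u r x ω i) μ :=
        ((hu2 r x).continuousLinearMap_comp (EuclideanSpace.proj (𝕜 := ℝ) i)).1
      refine hur.sub (Finset.aestronglyMeasurable_fun_sum _ fun n _ => ?_)
      exact (((hI i n r).1.1.const_mul _).add ((hI' i n r).1.1.const_mul _)).const_mul _
    refine tendsto_of_tendsto_of_tendsto_of_le_of_le tendsto_const_nhds h0
      (fun _ => zero_le) fun N => ?_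
    refine le_of_eq_of_le ?_ ((eLpNorm_sub_le (hpart s N) (hpart t N) (by norm_num)).trans_eq
      (add_comm _ _))
    congr 1
    funext ω
    rw [Finset.sum_disjSum, ← Finset.sum_add_distrib, Pi.sub_apply]
    have : ∑ n ∈ Finset.range N, (w (Sum.inl n) * D (Sum.inl n) ω +
        w (Sum.inr n) * D (Sum.inr n) ω) =
        ∑ n ∈ Finset.range N, √(q n) *
          (Real.Angle.cos (n • x) * I i n t ω + Real.Angle.sin (n • x) * I' i n t ω) -
        ∑ n ∈ Finset.range N, √(q n) *
          (Real.Angle.cos (n • x) * I i n s ω + Real.Angle.sin (n • x) * I' i n s ω) := by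
      rw [← Finset.sum_sub_distrib]
      refine Finset.sum_congr rfl fun n _ => ?_
      simp only [w, D, Sum.elim_inl, Sum.elim_inr]
      ring
    rw [this]
    ring
  refine ⟨IsStrictlySubgaussian.of_tendsto (fun N => (hiso N).1) hmem hlim, ?_⟩
  have h := tendsto_integral_norm_sq (fun N => (hiso N).1.1) hmem hlim
  exact h.congr fun N => ((hiso N).2.trans (hvar N))

lemma timeMetricSq_eq_sum (hu : IsMildSolution q β β' μ u) (x : Real.Angle) (s t : ℝ≥0) :
    timeMetricSq μ u x s t = ∑ i, ∫ ω, ‖u t x ω i - u s x ω i‖ ^ 2 ∂μ := by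
  unfold timeMetricSq
  simp_rw [EuclideanSpace.norm_sq_eq, PiLp.sub_apply]
  exact integral_finsetSum _ fun i _ =>
    (hu.memLp_apply_sub x s t i).integrable_norm_pow two_ne_zero

end Solution

lemma rpow_min_eq_sq {h : ℝ} (hh : 0 ≤ h) (α H : ℝ) :
    h ^ min α (2 * H) = (h ^ min (α / 2) H) ^ 2 := by
  rw [← Real.rpow_natCast, ← Real.rpow_mul hh, min_mul_of_nonneg _ _ (by positivity)]
  congr 2 <;> push_cast <;> ring

theorem proposition2p3 (d : ℕ) (hd : 1 ≤ d) (H : ℝ) (hH : H ∈ Set.Ioo (0 : ℝ) 1)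
    (α : ℝ) (hα : α ∈ Set.Ioc (0 : ℝ) 1) (hαH : α ≠ 2 * H)
    (t₀ T : ℝ≥0) (ht₀ : t₀ ∈ Set.Ioc (0 : ℝ≥0) 1) (hT : 0 < T)
    -- the constants of the hypothesis on the Fourier coefficients
    (a A M : ℝ) (ha : 0 < a) (hA : 0 < A) (n₀ : ℕ) (hn₀ : 1 ≤ n₀) :
    ∃ c C K : ℝ, 0 < c ∧ 0 < C ∧ 0 < K ∧
      ∀ q : ℕ → ℝ, (∀ n, 0 ≤ q n) → (∀ n < n₀, q n ≤ M) →
      (∀ n ≥ n₀, a * (n : ℝ) ^ (4 * H - 2 * α - 1) ≤ q n ∧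
        q n ≤ A * (n : ℝ) ^ (4 * H - 2 * α - 1)) →
      ∀ (Ω : Type*) [MeasurableSpace Ω] (μ : Measure Ω) [IsProbabilityMeasure μ]
        (β β' : Fin d → ℕ → ℝ≥0 → Ω → ℝ)
        (u : ℝ≥0 → Real.Angle → Ω → EuclideanSpace ℝ (Fin d)),
      IsDrivingNoise H β β' μ → IsMildSolution q β β' μ u →
      ∀ x : Real.Angle,
        -- two-sided bound on the canonical metric
        (∀ s ∈ Set.Icc t₀ T, ∀ t ∈ Set.Icc t₀ T, |(t : ℝ) - s| ≤ t₀ / 2 →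
          c * |(t : ℝ) - s| ^ min α (2 * H) ≤ timeMetricSq μ u x s t ∧
          timeMetricSq μ u x s t ≤ C * |(t : ℝ) - s| ^ min α (2 * H)) ∧
        -- there is a continuous version
        (∃ v, IsContinuousVersionOn μ t₀ T (fun t => u t x) v) ∧
        -- and every continuous version is Hölder continuous, with the modulus of continuity
        ∀ v, IsContinuousVersionOn μ t₀ T (fun t => u t x) v →
          (∀ᵐ ω ∂μ, ∀ b : ℝ≥0, 0 < b → (b : ℝ) < min (α / 2) H →
            ∃ L : ℝ≥0, HolderOnWith L b (fun t => v t ω) (Set.Icc t₀ T)) ∧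
          (∀ᵐ ω ∂μ, ∃ ε > (0 : ℝ), ∀ s ∈ Set.Icc t₀ T, ∀ t ∈ Set.Icc t₀ T,
            0 < |(t : ℝ) - s| → |(t : ℝ) - s| < ε →
            ‖v t ω - v s ω‖ ≤
              K * (|(t : ℝ) - s| ^ min (α / 2) H * √(Real.log (1 / |(t : ℝ) - s|)))) := by
  have hγ : 0 < min (α / 2) H := lt_min (half_pos hα.1) hH.1
  have ht₀' : (0 : ℝ) < t₀ := ht₀.1
  have hd0 : (1 : ℝ) ≤ d := by exact_mod_cast hd
  obtain ⟨C, hC, hupper⟩ := exists_sum_incrementVar_le hH hα.1 hαH hA M hn₀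
  obtain ⟨c, hc, hlower⟩ := exists_le_sum_incrementVar hH hα.1 ha ht₀' hn₀
  refine ⟨c, d * C, modulusConst (min (α / 2) H) (gapConst d C), hc, by positivity,
    modulusConst_pos (gapConst_pos hd hC), ?_⟩
  intro q hq hqM hqn Ω _ μ _ β β' u hβ hu x
  have hle : ∀ s t : ℝ≥0, 0 < |(t : ℝ) - s| → |(t : ℝ) - s| ≤ 1 → ∀ i,
      ∫ ω, ‖u t x ω i - u s x ω i‖ ^ 2 ∂μ ≤ C * |(t : ℝ) - s| ^ min α (2 * H) :=
    fun s t h0 h1 i => le_of_tendsto (hu.increment hH hq hβ x s t i).2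
      (Eventually.of_forall fun N =>
        hupper q hq hqM (fun n hn => (hqn n hn).2) s s.coe_nonneg t t.coe_nonneg h0 h1 N)
  have hinc : HasSubgaussianIncrements μ (fun t => u t x) t₀ T (min (α / 2) H) C :=
    fun s _ t _ h0 h1 i => ⟨(hu.increment hH hq hβ x s t i).1, by
      rw [← rpow_min_eq_sq (abs_nonneg _)]; exact hle s t h0 h1 i⟩
  refine ⟨fun s hs t ht hst => ?_, ?_, fun v hv => ⟨?_, ?_⟩⟩
  · rcases (abs_nonneg ((t : ℝ) - s)).eq_or_lt with h0 | h0
    · have hts : t = s := NNReal.coe_injective (sub_eq_zero.1 (abs_eq_zero.1 h0.symm))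
      have hmin : min α (2 * H) ≠ 0 := (lt_min hα.1 (by linarith [hH.1])).ne'
      subst hts
      simp [timeMetricSq, Real.zero_rpow hmin]
    have h1 : |(t : ℝ) - s| ≤ 1 := by
      have : (t₀ : ℝ) ≤ 1 := ht₀.2
      linarith
    rw [timeMetricSq_eq_sum hu]
    constructor
    · have hi : ∀ i, c * |(t : ℝ) - s| ^ min α (2 * H) ≤
          ∫ ω, ‖u t x ω i - u s x ω i‖ ^ 2 ∂μ := fun i => by
        obtain ⟨N, hN⟩ := hlower q hq (fun n hn => (hqn n hn).1) s hs.1 t ht.1 h0 h1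
        refine hN.trans (Monotone.ge_of_tendsto (monotone_nat_of_le_succ fun N => ?_)
          (hu.increment hH hq hβ x s t i).2 N)
        rw [Finset.sum_range_succ]
        exact le_add_of_nonneg_right (mul_nonneg (hq _) (incrementVar_nonneg _ _ _ _))
      refine (hi ⟨0, hd⟩).trans (Finset.single_le_sum
        (f := fun i => ∫ ω, ‖u t x ω i - u s x ω i‖ ^ 2 ∂μ)
        (fun i _ => integral_nonneg fun ω => by positivity) (Finset.mem_univ _))
    · refine (Finset.sum_le_card_nsmul _ _ _ fun i _ => hle s t h0 h1 i).trans_eq ?_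
      rw [Finset.card_univ, Fintype.card_fin, nsmul_eq_mul, mul_assoc]
  · exact hinc.exists_isContinuousVersionOn hd hC hγ fun t => hu.1 t x
  · exact hinc.ae_holderOnWith hd hC hγ hv
  · exact hinc.ae_modulus hd hC hγ hv
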